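/- There are absolute constants $c_1,c_2>0$ such that the following holds. Setting. Let $n,m\ge 1$ and write $\theta=(A,B)$, $\theta z=Ax+Bu$ for $z=(x,u)\in\mathbb R^n\times\mathbb R^m$; $\|\cdot\|_2$ is the Euclidean norm of vectors and the spectral norm of matrices. Let $\Theta_0$ be a set of parameters with $\theta_*=(A_*,B_*)\in\Theta_0$ and $\theta_0=(A_0,B_0)\in\Theta_0$. Let $\mathbb X\subseteq\mathbb R^n$, $\mathbb U\subseteq\mathbb R^m$ be nonempty bounded constraint sets and $b_z=\sup_{x\in\mathbb X,u\in\mathbb U}\sqrt{\|x\|_2^2+\|u\|_2^2}$ (the maximum, when it is attained). Noise. $(w_t)_{t\ge0}$ in $\mathbb R^n$ and $(\eta_t)_{t\ge0}$ in $\mathbb R^m$ are i.i.d. zero-mean sequences, independent of each other, with $\|w_t\|_2\le w_{\max}$, $\|\eta_t\|_2\le\eta_{\max}$ a.s., $\lambda_{\min}(\mathrm{cov}(w_t))\ge\sigma_w^2$, $\lambda_{\min}(\mathrm{cov}(\eta_t))\ge\sigma_\eta^2$, where $\sigma_w,\sigma_\eta>0$. Put $\bar w=w_{\max}/\sigma_w$,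 $\bar\eta=\eta_{\max}/\sigma_\eta$, $\mathbb W=\{\|w\|_2\le w_{\max}\}$, $\mathbb H=\{\|\eta\|_2\le\eta_{\max}\}$. Controller. Let $K\in\mathbb R^{m\times n}$ and $$\mathbb S_\eta=\{w+(\theta-\theta_0)z+B_0\eta:\ w\in\mathbb W,\ z\in\mathbb X\times\mathbb U,\ \theta\in\Theta_0,\ \eta\in\mathbb H\},\qquad \mathbb S_{K,\eta}=\sum_{i=0}^{\infty}(A_0+B_0K)^i\,\mathbb S_\eta$$ (the set of all sums of convergent series $\sum_i(A_0+B_0K)^is_i$ with $s_i\in\mathbb S_\eta$). Let $P\ominus S=\{y:\ y+s\in P\ \ \forall s\in S\}$, and put $\bar{\mathbb X}=\mathbb X\ominus\mathbb S_{K,\eta}$, $\bar{\mathbb U}=\mathbb U\ominus(K\mathbb S_{K,\eta}\oplus\mathbb H)$. Given a horizon $W\ge1$, weights $Q,R$, a terminal cost $V_f$ and a terminal set $\mathbb X_f$, the RMPC problem at a state $x$ is to minimize $$\sum_{k=0}^{W-1}\big(\bar x_k^\top Q\bar x_k+\bar u_k^\top R\bar u_k\big)+V_f(\bar x_W)$$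 over $\bar x_0,v_0,\dots,v_{W-1}$, subject to $\bar u_k=K\bar x_k+v_k$, $\bar x_{k+1}=A_0\bar x_k+B_0\bar u_k$, $\bar x_k\in\bar{\mathbb X}$ and $\bar u_k\in\bar{\mathbb U}$ for $0\le k\le W-1$, $\bar x_W\in\mathbb X_f$, and an initial constraint, which is either (a) $\bar x_0=x$, or (b) $x-\bar x_0\in\mathbb S_{K,\eta}$. An RMPC input at $x$ is $Kx+v_0^*$, where $(\bar x_0^*,v^*)$ is an optimal solution of the problem at $x$. Trajectory. Let $\pi:\mathbb R^n\to\mathbb R^m$ be measurable, $x_0\in\mathbb R^n$, and $x_{t+1}=A_*x_t+B_*u_t+w_t$, $u_t=\pi(x_t)+\eta_t$, $z_t=(x_t,u_t)$. Let $T\in\mathbb N$. Assume that the trajectory is generated by RMPC with excitation, in one of the following two senses: (a) with the initial constraint (a), almost surely $\pi(x_t)$ is an RMPC input at $x_t$ for all $0\le t\le T$ (in particular, the problem is feasible along the trajectory); or (b) with the initial constraint (b), $\pi(x)$ is an RMPC input at $x$ for every $x$ at which the problem is feasible, the problem is feasible at $x_0$, $\mathbb X_f\subseteq\bar{\mathbb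 X}$, and for every $x\in\mathbb X_f$ there is $u\in\bar{\mathbb U}$ with $A_0x+B_0u\in\mathbb X_f$. Estimate. Let $\hat\theta\in\arg\min_\theta\sum_{s=1}^T\|x_s-\theta z_{s-1}\|_2^2$ and $\tilde\theta\in\arg\min_{\theta\in\Theta_0}\|\hat\theta-\theta\|_2^2$ (any minimizers). Conclusion. Let $0<\delta<1/3$, $$\mathrm{poly}_1=\max\Big(\frac{\bar w}{\sigma_w},\frac{\bar\eta}{\sigma_\eta},\frac{\bar w\bar\eta}{\sigma_w\sigma_\eta}\Big)\max(\bar w,\bar\eta),\qquad \mathrm{poly}_2=\bar w\max(\bar w^2,\bar\eta^2)\max(\bar w\sigma_\eta,\bar\eta\sigma_w,\bar w\bar\eta).$$ If $$T\ \ge\ c_1\,(m+n)\max(\bar w^4,\bar\eta^4)\log\Big(\frac{b_z}{\delta}\,\mathrm{poly}_1\Big),$$ then, with probability at least $1-3\delta$, $$\|\tilde\theta-\theta_*\|_2\ \le\ c_2\,\frac{b_z\sqrt{m+n}}{\sqrt T\,\sigma_\eta}\,\mathrm{poly}_2\,\sqrt{\log\Big(\frac{b_z}{\delta}\Big)+\log(\mathrm{poly}_1)}.$$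 -/

import Mathlib

open MeasureTheory ProbabilityTheory
open scoped Pointwise

noncomputable section

namespace RMPC

/-- `ℝ^d` with the Euclidean norm. -/
abbrev E (d : ℕ) : Type := EuclideanSpace ℝ (Fin d)

/-- The space of `z = (x, u)`, with `‖z‖² = ‖x‖² + ‖u‖²`. -/
abbrev Z (n m : ℕ) : Type := WithLp 2 (E n × E m)

/-- System parameters `θ = (A, B)`, acting by `θ (x, u) = A x + B u`; the norm is the operator
norm between Euclidean spaces, that is, the spectral norm of the matrix `(A, B)`. -/
abbrev Param (n m : ℕ) : Type := Z n m →L[ℝ] E n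

/-- The stacked vector `(x, u)`. -/
def pair {n m : ℕ} (x : E n) (u : E m) : Z n m := WithLp.toLp 2 (x, u)

/-- The covariance matrix of a random vector. -/
def covMatrix {Ω : Type*} [MeasurableSpace Ω] {d : ℕ} (μ : Measure Ω) (ξ : Ω → E d) :
    Matrix (Fin d) (Fin d) ℝ :=
  Matrix.of fun i j => cov[fun ω => ξ ω i, fun ω => ξ ω j; μ]

/-- An i.i.d. zero mean sequence bounded by `r`, whose covariance matrix has all its eigenvalues
at least `σ ^ 2 > 0`. -/
structure IsNoise {Ω : Type*} [MeasurableSpace Ω] {d : ℕ} (μ : Measure Ω) (ξ : ℕ → Ω → E d)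
    (r σ : ℝ) : Prop where
  meas : ∀ t, Measurable (ξ t)
  indep : iIndepFun ξ μ
  ident : ∀ t, IdentDistrib (ξ t) (ξ 0) μ μ
  mean : ∀ t, ∫ ω, ξ t ω ∂μ = 0
  bdd : ∀ t, ∀ᵐ ω ∂μ, ‖ξ t ω‖ ≤ r
  pos : 0 < σ
  cov : ∀ t, (covMatrix μ (ξ t) - σ ^ 2 • (1 : Matrix (Fin d) (Fin d) ℝ)).PosSemidef

/-- The Pontryagin difference `S ⊖ P`: the points around which the whole of `P` fits in `S`. -/
def erode {F : Type*} [Add F] (S P : Set F) : Set F := {x | ∀ p ∈ P, x + p ∈ S}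

/-- The design data of the robust model predictive controller. -/
structure Design (n m : ℕ) where
  /-- state constraint set -/
  X : Set (E n)
  /-- input constraint set -/
  U : Set (E m)
  /-- prior parameter set -/
  Θ₀ : Set (Param n m)
  /-- nominal parameter `(A₀, B₀)` -/
  θ₀ : Param n m
  /-- feedback gain -/
  K : E n →L[ℝ] E m
  /-- state weight -/
  Q : E n →L[ℝ] E n
  /-- input weight -/
  R : E m →L[ℝ] E m
  /-- terminal cost -/
  Vf : E n → ℝ
  /-- terminal constraint set -/
  Xf : Set (E n)
  /-- horizon -/
  W : ℕ
  /-- radius of the process noise set -/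
  wmax : ℝ
  /-- radius of the excitation set -/
  ηmax : ℝ

namespace Design

variable {n m : ℕ} (D : Design n m)

/-- `𝕎`, the ball that contains the process noise. -/
def noiseSet : Set (E n) := Metric.closedBall 0 D.wmax

/-- `ℍ`, the ball that contains the excitation. -/
def excitationSet : Set (E m) := Metric.closedBall 0 D.ηmax

/-- `A₀ + B₀ K`. -/
def AK : E n →L[ℝ] E n :=
  D.θ₀ ∘L ((WithLp.prodContinuousLinearEquiv 2 ℝ (E n) (E m)).symm :
    E n × E m →L[ℝ] Z n m) ∘L ((ContinuousLinearMap.id ℝ (E n)).prod D.K)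

/-- `𝕊`, the lumped uncertainty `w + (θ - θ₀) z` with `w ∈ 𝕎`, `z ∈ X × U`, `θ ∈ Θ₀`. -/
def lumpedSet : Set (E n) :=
  {s | ∃ w ∈ D.noiseSet, ∃ x ∈ D.X, ∃ u ∈ D.U, ∃ θ ∈ D.Θ₀, s = w + (θ - D.θ₀) (pair x u)}

/-- `𝕊_η = 𝕊 ⊕ B₀ ℍ`, the lumped uncertainty with the excitation. -/
def lumpedExcitedSet : Set (E n) :=
  D.lumpedSet + (fun η : E m => D.θ₀ (pair 0 η)) '' D.excitationSet

/-- The tube `𝕊_{K,η} = ∑ i, (A₀ + B₀ K) ^ i 𝕊_η`: all sums of convergent series with `i`-th term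
in `(A₀ + B₀ K) ^ i 𝕊_η`. -/
def tube : Set (E n) :=
  {e | ∃ s : ℕ → E n, (∀ i, s i ∈ D.lumpedExcitedSet) ∧
    HasSum (fun i => (D.AK ^ i) (s i)) e}

/-- The tightened state constraint `X ⊖ 𝕊_{K,η}`. -/
def tightX : Set (E n) := erode D.X D.tube

/-- The tightened input constraint `U ⊖ (K 𝕊_{K,η} ⊕ ℍ)`. -/
def tightU : Set (E m) := erode D.U (D.K '' D.tube + D.excitationSet)

/-- Nominal states predicted from `xbar`, with inputs `K x_k + v_k`. -/
def predX (xbar : E n) (v : ℕ → E m) : ℕ → E n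
  | 0 => xbar
  | k + 1 => D.θ₀ (pair (predX xbar v k) (D.K (predX xbar v k) + v k))

/-- Nominal inputs `K x_k + v_k`. -/
def predU (xbar : E n) (v : ℕ → E m) (k : ℕ) : E m := D.K (D.predX xbar v k) + v k

/-- The finite-horizon cost; only `v 0, …, v (W - 1)` enter. -/
def cost (xbar : E n) (v : ℕ → E m) : ℝ :=
  (∑ k ∈ Finset.range D.W,
    (inner ℝ (D.predX xbar v k) (D.Q (D.predX xbar v k)) +
      inner ℝ (D.predU xbar v k) (D.R (D.predU xbar v k)))) + D.Vf (D.predX xbar v D.W)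

/-- Feasibility of the nominal initial state `xbar` and the corrections `v` when the measured state
is `x`. The set `I` constrains the nominal initial state: `I = {0}` means `xbar = x`, and
`I = 𝕊_{K,η}` only asks that `x` lies in the tube around `xbar`. -/
def Feasible (I : Set (E n)) (x xbar : E n) (v : ℕ → E m) : Prop :=
  x - xbar ∈ I ∧
    (∀ k < D.W, D.predX xbar v k ∈ D.tightX ∧ D.predU xbar v k ∈ D.tightU) ∧
    D.predX xbar v D.W ∈ D.Xf

/-- `u = K x + v 0`, where `(xbar, v)` is an optimal solution of the problem at `x`. -/
def IsInput (I : Set (E n)) (x : E n) (u : E m) : Prop :=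
  ∃ (xbar : E n) (v : ℕ → E m), D.Feasible I x xbar v ∧
    (∀ (xbar' : E n) (v' : ℕ → E m), D.Feasible I x xbar' v' → D.cost xbar v ≤ D.cost xbar' v') ∧
    u = D.K x + v 0

/-- The terminal set lies in the tightened state set and can be kept invariant for the nominal
system with tightened inputs. -/
def TerminalInvariant : Prop :=
  D.Xf ⊆ D.tightX ∧ ∀ x ∈ D.Xf, ∃ u ∈ D.tightU, D.θ₀ (pair x u) ∈ D.Xf

end Design

section trajectory

variable {Ω : Type*} {n m : ℕ}

/-- The closed-loop states: `x_{t+1} = A x_t + B u_t + w_t` with `u_t = π x_t + η_t`. -/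
def state (θ : Param n m) (π : E n → E m) (x₀ : E n) (w : ℕ → Ω → E n) (η : ℕ → Ω → E m) :
    ℕ → Ω → E n
  | 0, _ => x₀
  | t + 1, ω =>
    θ (pair (state θ π x₀ w η t ω) (π (state θ π x₀ w η t ω) + η t ω)) + w t ω

/-- The stacked vectors `z_t = (x_t, u_t)`. -/
def stacked (θ : Param n m) (π : E n → E m) (x₀ : E n) (w : ℕ → Ω → E n) (η : ℕ → Ω → E m)
    (t : ℕ) (ω : Ω) : Z n m :=
  pair (state θ π x₀ w η t ω) (π (state θ π x₀ w η t ω) + η t ω)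

end trajectory

/-- `θhat` minimizes `∑_{s=1}^T ‖x_s - θ z_{s-1}‖²`. -/
def IsLeastSquares {n m : ℕ} (T : ℕ) (x : ℕ → E n) (z : ℕ → Z n m) (θhat : Param n m) : Prop :=
  ∀ θ : Param n m, ∑ s ∈ Finset.range T, ‖x (s + 1) - θhat (z s)‖ ^ 2 ≤
    ∑ s ∈ Finset.range T, ‖x (s + 1) - θ (z s)‖ ^ 2

/-- `p` is a point of `S` nearest to `a`. -/
def IsProjection {F : Type*} [NormedAddCommGroup F] (S : Set F) (a p : F) : Prop :=
  p ∈ S ∧ ∀ q ∈ S, ‖a - p‖ ^ 2 ≤ ‖a - q‖ ^ 2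

/-- `max(w̄/σ_w, η̄/σ_η, w̄η̄/(σ_w σ_η)) · max(w̄, η̄)`. -/
def poly₁ (wb ηb σw ση : ℝ) : ℝ :=
  max (max (wb / σw) (ηb / ση)) (wb * ηb / (σw * ση)) * max wb ηb

/-- `w̄ · max(w̄², η̄²) · max(w̄ σ_η, η̄ σ_w, w̄ η̄)`. -/
def poly₂ (wb ηb σw ση : ℝ) : ℝ :=
  wb * max (wb ^ 2) (ηb ^ 2) * max (max (wb * ση) (ηb * σw)) (wb * ηb)

end RMPC

end

namespace RMPC

open scoped ENNReal

/-! ### Mixtures of exponential moments over balls -/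

section mixture

/-! Write `b` for `b_z` and `X = max(w̄, η̄)`.

Robustness. If the plan at `x` is feasible, then `x` and the excited input satisfy the constraints,
because the tightened sets leave room for the tube and the excitation. Sense (a) gives feasibility
at every visited state; sense (b) gives it by recursive feasibility (`Design.Feasible.exists_next`).
So `‖z_t‖ ≤ b` almost surely, and truncating `π` at `b` gives a policy bounded everywhere that
leaves the regressors unchanged. The tube contains the noise ball, so the noise radii are also at
most `b`.

Excitation. Given the past, `⟨c, z_{t+1}⟩` with `‖c‖ ≥ 1` is anti-concentrated at scale `s = σ_w σ_η
/ (64 b)`: through `η` if the input part of `c` is not tiny, and through `w` otherwise, the input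
term then being a small perturbation. Iterating, `exp (-∑ ⟨c, z_t⟩² / s²)` has exponentially small
mean for each fixed `c` (`lintegral_exp_neg_gram_le`).

Noise. Each row `Δ` of `θhat - θstar` solves normal equations driven by one coordinate `ξ = w_i`. By
Hoeffding's lemma, with `M` the noise radius, `exp (∑ (ξ_t ⟨a, z_t⟩ - M² ⟨a, z_t⟩² / 2))` has mean
at most `1` for each fixed `a` (`lintegral_exp_cross_le`).

Uniformity. Instead of a net, both exponentials are integrated over a region of directions with
respect to Haar measure, and Markov's inequality is applied once. A bad direction keeps the
integrand large on a whole ball (Gram form) or half ball (noise) around it, so the only price is a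
ratio of volumes, that is, `d = n + m` times a logarithm in the exponent. This gives a Gram form at
least `l ≍ s² T / X²` and rows of norm at most `ε ≍ M X √(d L) / (s √T)`, where `L` is the
logarithmic factor.

Conclusion. Passing from rows to the operator norm costs `√n ≤ w̄`, a trace bound for the
covariance, and projecting onto `Θ₀` costs a factor `2`. The total failure probability is at most
`2δ`. -/

lemma sum_inner_sq_le {F : Type*} [NormedAddCommGroup F] [InnerProductSpace ℝ F] {T : ℕ}
    {z : ℕ → F} {b : ℝ} (hz : ∀ s < T, ‖z s‖ ≤ b) (c : F) :
    ∑ s ∈ Finset.range T, inner ℝ c (z s) ^ 2 ≤ T * b ^ 2 * ‖c‖ ^ 2 := by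
  have : ∀ s ∈ Finset.range T, inner ℝ c (z s) ^ 2 ≤ b ^ 2 * ‖c‖ ^ 2 := fun s hs => by
    have h1 := abs_real_inner_le_norm c (z s)
    have h2 := hz s (Finset.mem_range.1 hs)
    rw [← mul_pow, mul_comm]
    exact sq_le_sq' (by nlinarith [neg_abs_le (inner ℝ c (z s)), norm_nonneg c])
      (by nlinarith [le_abs_self (inner ℝ c (z s)), norm_nonneg c])
  refine (Finset.sum_le_sum this).trans ?_
  simp [mul_assoc]

/-- A half ball and its reflection cover the ball. This allows a term linear in the displacement to
be dropped at the cost of a factor `2`. -/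
lemma measure_ball_le_two_mul {F : Type*} [NormedAddCommGroup F] [MeasurableSpace F]
    [BorelSpace F] (ν : Measure F) [ν.IsNegInvariant] (r : ℝ) {ℓ : F → ℝ}
    (hneg : ∀ y, ℓ (-y) = -ℓ y) :
    ν (Metric.ball 0 r) ≤ 2 * ν (Metric.ball 0 r ∩ {y | 0 ≤ ℓ y}) := by
  have hsub : Metric.ball (0 : F) r ⊆
      (Metric.ball 0 r ∩ {y | 0 ≤ ℓ y}) ∪ -(Metric.ball 0 r ∩ {y | 0 ≤ ℓ y}) := by
    intro y hy
    rcases le_total 0 (ℓ y) with h | h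
    · exact Or.inl ⟨hy, h⟩
    · exact Or.inr ⟨by simpa using hy, by simpa [hneg] using h⟩
  refine (measure_mono hsub).trans ((measure_union_le _ _).trans ?_)
  rw [Measure.measure_neg, two_mul]

variable {Ω F : Type*} [MeasurableSpace Ω] {μ : Measure Ω} [IsProbabilityMeasure μ]

/-- Markov's inequality for the average of a family of random variables over a set of indices. -/
lemma measure_le_setLIntegral_le [MeasurableSpace F] (ν : Measure F) [SFinite ν] {S : Set F}
    (hS : MeasurableSet S) {G : Ω → F → ℝ≥0∞} (hG : Measurable (Function.uncurry G))
    {k κ δ : ℝ≥0∞} (hk : ∀ c ∈ S, ∫⁻ ω, G ω c ∂μ ≤ k) (hκ0 : κ ≠ 0) (hκ : κ ≠ ⊤)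
    (h : k * ν S ≤ δ * κ) : μ {ω | κ ≤ ∫⁻ c in S, G ω c ∂ν} ≤ δ := by
  have hm : Measurable fun ω => ∫⁻ c in S, G ω c ∂ν := hG.lintegral_prod_right'
  refine (meas_ge_le_lintegral_div hm.aemeasurable hκ0 hκ).trans ?_
  rw [ENNReal.div_le_iff hκ0 hκ]
  refine le_trans ?_ h
  rw [lintegral_lintegral_swap hG.aemeasurable, ← setLIntegral_const]
  exact setLIntegral_mono' hS hk

variable [NormedAddCommGroup F] [InnerProductSpace ℝ F] [FiniteDimensional ℝ F]
  [MeasurableSpace F] [BorelSpace F]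

/-- A quadratic form with small exponential moments is bounded below on the unit sphere with high
probability. -/
lemma measure_exists_sum_inner_sq_lt_le {T : ℕ} {z : ℕ → Ω → F} (hz : ∀ s, Measurable (z s))
    {b s P l r δ : ℝ} (hs : 0 < s) (hr : 0 < r) (hr' : r ≤ 1 / 2) (hδ : 0 < δ)
    (hexp : ∀ c : F, 1 ≤ ‖c‖ →
      ∫⁻ ω, ENNReal.ofReal (Real.exp (-(∑ t ∈ Finset.range T, inner ℝ c (z t ω) ^ 2) / s ^ 2)) ∂μ
        ≤ ENNReal.ofReal (Real.exp (-P)))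
    (hnum : 2 ^ Module.finrank ℝ F * Real.exp (-P) ≤
      δ * (r ^ Module.finrank ℝ F * Real.exp (-(9 / 2 * l + 2 * r ^ 2 * T * b ^ 2) / s ^ 2))) :
    μ {ω | (∀ t < T, ‖z t ω‖ ≤ b) ∧
      ∃ c : F, ‖c‖ = 1 ∧ ∑ t ∈ Finset.range T, inner ℝ c (z t ω) ^ 2 < l} ≤ ENNReal.ofReal δ := by
  set ν : Measure F := Measure.addHaar
  set v := ν (Metric.ball 0 1) with hv
  have hv0 : v ≠ 0 := (Metric.measure_ball_pos ν 0 one_pos).ne'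
  have hvt : v ≠ ⊤ := measure_ball_lt_top.ne
  set d := Module.finrank ℝ F
  set S : Set F := {c | 1 ≤ ‖c‖} ∩ Metric.ball 0 2
  set E₀ := Real.exp (-(9 / 2 * l + 2 * r ^ 2 * T * b ^ 2) / s ^ 2)
  set κ : ℝ≥0∞ := ENNReal.ofReal E₀ * (ENNReal.ofReal (r ^ d) * v)
  set G : Ω → F → ℝ≥0∞ := fun ω c =>
    ENNReal.ofReal (Real.exp (-(∑ t ∈ Finset.range T, inner ℝ c (z t ω) ^ 2) / s ^ 2))
  have hG : Measurable (Function.uncurry G) := by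
    refine ENNReal.measurable_ofReal.comp (Real.measurable_exp.comp ?_)
    refine Measurable.div_const (Measurable.neg (Finset.measurable_sum _ fun t _ => ?_)) _
    exact (measurable_snd.inner ((hz t).comp measurable_fst)).pow_const 2
  have hE : 0 < E₀ := Real.exp_pos _
  have hS : MeasurableSet S :=
    (measurableSet_le measurable_const measurable_norm).inter Metric.isOpen_ball.measurableSet
  refine (measure_mono ?_).trans (measure_le_setLIntegral_le (κ := κ) ν hS hG
    (fun c hc => hexp c hc.1) ?_ ?_ ?_)
  · rintro ω ⟨hb, c, hc, hlt⟩
    -- The centre is moved to the middle of the annulus `1 ≤ ‖y‖ < 2`, so that the ball of radius `r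
    -- ≤ 1/2` stays where `hexp` applies.
    have hsub : Metric.ball ((3 / 2 : ℝ) • c) r ⊆ S := by
      intro y hy
      rw [Metric.mem_ball, dist_eq_norm] at hy
      have hn : ‖(3 / 2 : ℝ) • c‖ = 3 / 2 := by rw [norm_smul, hc]; norm_num
      have h1 := norm_sub_norm_le ((3 / 2 : ℝ) • c) y
      have h2 := norm_sub_norm_le y ((3 / 2 : ℝ) • c)
      rw [norm_sub_rev] at h1
      exact ⟨show 1 ≤ ‖y‖ by linarith, by rw [mem_ball_zero_iff]; linarith⟩
    have hle : ∀ y ∈ Metric.ball ((3 / 2 : ℝ) • c) r, ENNReal.ofReal E₀ ≤ G ω y := by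
      intro y hy
      rw [Metric.mem_ball, dist_eq_norm] at hy
      refine ENNReal.ofReal_le_ofReal (Real.exp_le_exp.2 ?_)
      rw [div_le_div_iff_of_pos_right (by positivity), neg_le_neg_iff]
      have h1 := sum_inner_sq_le (z := fun t => z t ω) hb (y - (3 / 2 : ℝ) • c)
      -- `(p + q)² ≤ 2p² + 2q²` with `p` coming from `(3/2) c`; hence `9/2 = 2 · (3/2)²`.
      have h2 : ∑ t ∈ Finset.range T, inner ℝ y (z t ω) ^ 2 ≤
          9 / 2 * ∑ t ∈ Finset.range T, inner ℝ c (z t ω) ^ 2 +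
          2 * ∑ t ∈ Finset.range T, inner ℝ (y - (3 / 2 : ℝ) • c) (z t ω) ^ 2 := by
        rw [Finset.mul_sum, Finset.mul_sum, ← Finset.sum_add_distrib]
        refine Finset.sum_le_sum fun t _ => ?_
        rw [inner_sub_left, real_inner_smul_left]
        nlinarith [sq_nonneg (inner ℝ y (z t ω) - 3 * inner ℝ c (z t ω))]
      have h3 : ‖y - (3 / 2 : ℝ) • c‖ ^ 2 ≤ r ^ 2 := by gcongr
      have h4 : T * b ^ 2 * ‖y - (3 / 2 : ℝ) • c‖ ^ 2 ≤ T * b ^ 2 * r ^ 2 := by gcongr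
      nlinarith
    calc κ = ∫⁻ _ in Metric.ball ((3 / 2 : ℝ) • c) r, ENNReal.ofReal E₀ ∂ν := by
          rw [setLIntegral_const, Measure.addHaar_ball_of_pos _ _ hr]
      _ ≤ ∫⁻ y in Metric.ball ((3 / 2 : ℝ) • c) r, G ω y ∂ν :=
          setLIntegral_mono' Metric.isOpen_ball.measurableSet hle
      _ ≤ ∫⁻ y in S, G ω y ∂ν := lintegral_mono_set hsub
  · refine mul_ne_zero (by simpa using hE) (mul_ne_zero ?_ hv0)
    simpa using pow_pos hr d
  · exact ENNReal.mul_ne_top ENNReal.ofReal_ne_top (ENNReal.mul_ne_top ENNReal.ofReal_ne_top hvt)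
  · have h2 : ν S ≤ ENNReal.ofReal (2 ^ d) * v :=
      (measure_mono Set.inter_subset_right).trans (Measure.addHaar_ball_of_pos _ _ two_pos).le
    calc ENNReal.ofReal (Real.exp (-P)) * ν S
        ≤ ENNReal.ofReal (Real.exp (-P)) * (ENNReal.ofReal (2 ^ d) * v) := by gcongr
      _ = ENNReal.ofReal (2 ^ d * Real.exp (-P)) * v := by
          rw [ENNReal.ofReal_mul (by positivity)]; ring
      _ ≤ ENNReal.ofReal (δ * (r ^ d * E₀)) * v := by gcongr
      _ = _ := by
          rw [ENNReal.ofReal_mul hδ.le, ENNReal.ofReal_mul (by positivity)]; ring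

/-- Self-normalized bound: a solution `Δ` of the normal equations with noise `ξ` is small with high
probability, as soon as the Gram form is at least `l` in the direction of `Δ`. -/
lemma measure_exists_normalEq_le {T : ℕ} {z : ℕ → Ω → F} (hz : ∀ s, Measurable (z s))
    {ξ : ℕ → Ω → ℝ} (hξ : ∀ s, Measurable (ξ s))
    {b M l r ε δ : ℝ} (hM : 0 < M) (hr : 0 < r) (hδ : 0 < δ) (hε : 0 < ε)
    (hl : 0 < l) (hrb : M ^ 2 * (T * b ^ 2 * r ^ 2) ≤ 1)
    (hexp : ∀ a : F,
      ∫⁻ ω, ENNReal.ofReal (Real.exp (∑ t ∈ Finset.range T,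
        (ξ t ω * inner ℝ a (z t ω) - M ^ 2 / 2 * inner ℝ a (z t ω) ^ 2))) ∂μ ≤ 1)
    (hnum : 2 * (ε / M ^ 2 + r) ^ Module.finrank ℝ F ≤
      δ * (r ^ Module.finrank ℝ F * Real.exp (ε ^ 2 * l / (2 * M ^ 2) - 1 / 2))) :
    μ {ω | (∀ t < T, ‖z t ω‖ ≤ b) ∧ ∃ Δ : F, ε < ‖Δ‖ ∧
      (∀ a : F, ∑ t ∈ Finset.range T, inner ℝ a (z t ω) * (ξ t ω - inner ℝ Δ (z t ω)) = 0) ∧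
      l * ‖Δ‖ ^ 2 ≤ ∑ t ∈ Finset.range T, inner ℝ Δ (z t ω) ^ 2} ≤ ENNReal.ofReal δ := by
  set ν : Measure F := Measure.addHaar
  set v := ν (Metric.ball 0 1) with hv
  have hv0 : v ≠ 0 := (Metric.measure_ball_pos ν 0 one_pos).ne'
  have hvt : v ≠ ⊤ := measure_ball_lt_top.ne
  set d := Module.finrank ℝ F
  set R := ε / M ^ 2 + r with hR
  have hRpos : 0 < R := by positivity
  set E₀ := Real.exp (ε ^ 2 * l / (2 * M ^ 2) - 1 / 2)
  have hE : 0 < E₀ := Real.exp_pos _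
  set κ : ℝ≥0∞ := ENNReal.ofReal (E₀ / 2) * (ENNReal.ofReal (r ^ d) * v)
  set f : Ω → F → ℝ := fun ω a => ∑ t ∈ Finset.range T,
        (ξ t ω * inner ℝ a (z t ω) - M ^ 2 / 2 * inner ℝ a (z t ω) ^ 2) with hf
  set G : Ω → F → ℝ≥0∞ := fun ω a => ENNReal.ofReal (Real.exp (f ω a))
  have hG : Measurable (Function.uncurry G) := by
    refine ENNReal.measurable_ofReal.comp (Real.measurable_exp.comp ?_)
    refine Finset.measurable_sum _ fun t _ => ?_
    have h1 : Measurable fun p : Ω × F => inner ℝ p.2 (z t p.1) :=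
      measurable_snd.inner ((hz t).comp measurable_fst)
    exact (((hξ t).comp measurable_fst).mul h1).sub ((h1.pow_const 2).const_mul _)
  refine (measure_mono ?_).trans (measure_le_setLIntegral_le (κ := κ) (k := 1)
    (S := Metric.ball 0 R) ν Metric.isOpen_ball.measurableSet hG (fun c _ => hexp c) ?_ ?_ ?_)
  · rintro ω ⟨hb, Δ, hΔε, hΔ, hΔl⟩
    have hΔ0 : 0 < ‖Δ‖ := hε.trans hΔε
    set q : F → ℝ := fun a => ∑ t ∈ Finset.range T, inner ℝ a (z t ω) ^ 2 with hq
    set B : F → ℝ := fun a => ∑ t ∈ Finset.range T, inner ℝ a (z t ω) * inner ℝ Δ (z t ω) with hB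
    -- The exponent along `Δ` peaks at the multiple `1 / M²`. Stopping earlier, at norm exactly `ε /
    -- M²`, keeps the centre in a fixed ball however large `Δ` is, and still retains `γ / 2` of the
    -- Gram form.
    set γ := ε / M ^ 2 / ‖Δ‖ with hγ
    have hγ0 : 0 < γ := by positivity
    have hγM : M ^ 2 * γ < 1 := by
      rw [hγ]; field_simp; exact hΔε
    set a₀ : F := γ • Δ with ha₀
    have hfa : ∀ a, f ω a = B a - M ^ 2 / 2 * q a := by
      intro a
      have h1 := hΔ a
      simp only [mul_sub, Finset.sum_sub_distrib] at h1
      simp only [hf, hB, hq, Finset.sum_sub_distrib, Finset.mul_sum]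
      rw [← sub_eq_zero.1 h1]
      simp [mul_comm]
    have hfe : ∀ e, f ω (a₀ + e) = (γ - M ^ 2 / 2 * γ ^ 2) * q Δ + (1 - M ^ 2 * γ) * B e
        - M ^ 2 / 2 * q e := by
      intro e
      rw [hfa]
      simp only [hB, hq, Finset.mul_sum, ← Finset.sum_sub_distrib, ← Finset.sum_add_distrib, ha₀,
        inner_add_left, real_inner_smul_left]
      refine Finset.sum_congr rfl fun t _ => ?_
      ring
    set H := Metric.ball (0 : F) r ∩ {y | 0 ≤ B y} with hH
    have hBm : Measurable B :=
      Finset.measurable_sum _ fun t _ => (measurable_id.inner measurable_const).mul_const _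
    have hHm : MeasurableSet H :=
      Metric.isOpen_ball.measurableSet.inter (measurableSet_le measurable_const hBm)
    -- `B` is the cross term of the expansion around `a₀`. It is odd, and nonnegative on `H`.
    have hhalf := measure_ball_le_two_mul ν r (ℓ := B) (fun y => by simp [hB])
    have hna : ‖a₀‖ = ε / M ^ 2 := by
      rw [ha₀, norm_smul, Real.norm_of_nonneg hγ0.le, hγ]; field_simp
    have hsub : (fun e => a₀ + e) '' H ⊆ Metric.ball 0 R := by
      rintro _ ⟨e, ⟨he, -⟩, rfl⟩
      rw [mem_ball_zero_iff] at he ⊢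
      exact (norm_add_le _ _).trans_lt (by rw [hna, hR]; linarith)
    have hle : ∀ e ∈ H, ENNReal.ofReal E₀ ≤ G ω (a₀ + e) := by
      rintro e ⟨he, hBe⟩
      rw [mem_ball_zero_iff] at he
      refine ENNReal.ofReal_le_ofReal (Real.exp_le_exp.2 ?_)
      rw [hfe]
      have h1 : q e ≤ T * b ^ 2 * ‖e‖ ^ 2 := sum_inner_sq_le (z := fun t => z t ω) hb e
      have h2 : T * b ^ 2 * ‖e‖ ^ 2 ≤ T * b ^ 2 * r ^ 2 := by gcongr
      have h3 : M ^ 2 * q e ≤ 1 :=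
        (mul_le_mul_of_nonneg_left (h1.trans h2) (sq_nonneg M)).trans hrb
      have h4 : 0 ≤ (1 - M ^ 2 * γ) * B e := mul_nonneg (by linarith) hBe
      have h5 : γ / 2 ≤ γ - M ^ 2 / 2 * γ ^ 2 := by nlinarith
      have h6 : γ / 2 * (l * ‖Δ‖ ^ 2) ≤ (γ - M ^ 2 / 2 * γ ^ 2) * q Δ :=
        mul_le_mul h5 hΔl (by positivity) (by linarith)
      have h7 : γ / 2 * (l * ‖Δ‖ ^ 2) = ε * l / (2 * M ^ 2) * ‖Δ‖ := by
        rw [hγ]; field_simp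
      have h8 : ε ^ 2 * l / (2 * M ^ 2) ≤ ε * l / (2 * M ^ 2) * ‖Δ‖ := by
        have : ε ^ 2 * l / (2 * M ^ 2) = ε * l / (2 * M ^ 2) * ε := by ring
        rw [this]; gcongr
      linarith
    calc κ = ENNReal.ofReal (E₀ / 2) * ν (Metric.ball 0 r) := by
          rw [Measure.addHaar_ball_of_pos _ _ hr]
      _ ≤ ENNReal.ofReal (E₀ / 2) * (2 * ν H) := by gcongr
      _ = ENNReal.ofReal E₀ * ν H := by
          rw [← mul_assoc, ← ENNReal.ofReal_ofNat 2, ← ENNReal.ofReal_mul (by positivity)]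
          congr 3; ring
      _ = ∫⁻ _ in H, ENNReal.ofReal E₀ ∂ν := by rw [setLIntegral_const]
      _ ≤ ∫⁻ e in H, G ω (a₀ + e) ∂ν := setLIntegral_mono' hHm hle
      _ = ∫⁻ y in (fun e => a₀ + e) '' H, G ω y ∂ν :=
          ((measurePreserving_add_left ν a₀).setLIntegral_comp_emb
            (measurableEmbedding_addLeft a₀) _ _)
      _ ≤ ∫⁻ y in Metric.ball 0 R, G ω y ∂ν := lintegral_mono_set hsub
  · refine mul_ne_zero (by simpa using hE) (mul_ne_zero ?_ hv0)
    simpa using pow_pos hr d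
  · exact ENNReal.mul_ne_top ENNReal.ofReal_ne_top (ENNReal.mul_ne_top ENNReal.ofReal_ne_top hvt)
  · rw [one_mul, Measure.addHaar_ball_of_pos _ _ hRpos]
    calc ENNReal.ofReal (R ^ d) * v ≤ ENNReal.ofReal (δ * (r ^ d * (E₀ / 2))) * v := by
          gcongr; linarith
      _ = _ := by
          rw [ENNReal.ofReal_mul hδ.le, ENNReal.ofReal_mul (by positivity)]; ring

end mixture

/-! ### Anti-concentration of bounded centred variables -/

section smallBall

variable {Ω : Type*} [MeasurableSpace Ω] {μ : Measure Ω} [IsProbabilityMeasure μ]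

/-- Anti-concentration of a bounded centred random variable, in exponential form and up to a small
perturbation. -/
lemma lintegral_exp_neg_sq_le {ξ g : Ω → ℝ} (hξ : Measurable ξ) {σ M c s : ℝ} (hσ : 0 < σ)
    (hmean : ∫ ω, ξ ω ∂μ = 0) (hvar : σ ^ 2 ≤ ∫ ω, ξ ω ^ 2 ∂μ) (hb : ∀ᵐ ω ∂μ, |ξ ω| ≤ M)
    (hs : 0 < s) (hsσ : s ≤ σ / 4) (hg : ∀ᵐ ω ∂μ, |g ω - (c + ξ ω)| ≤ σ / 4) :
    ∫⁻ ω, ENNReal.ofReal (Real.exp (-g ω ^ 2 / s ^ 2)) ∂μ ≤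
      ENNReal.ofReal (1 - σ ^ 2 / (24 * M ^ 2)) := by
  have hM0 : 0 ≤ M := by
    obtain ⟨ω, h⟩ := hb.exists
    exact (abs_nonneg _).trans h
  have hi : Integrable ξ μ := Integrable.of_bound hξ.aestronglyMeasurable M hb
  have hb2 : ∀ᵐ ω ∂μ, ξ ω ^ 2 ≤ M ^ 2 := hb.mono fun ω h => sq_le_sq' (abs_le.1 h).1 (abs_le.1 h).2
  have hi2 : Integrable (fun ω => ξ ω ^ 2) μ :=
    Integrable.of_bound (hξ.pow_const 2).aestronglyMeasurable (M ^ 2)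
      (hb2.mono fun ω h => by rwa [Real.norm_of_nonneg (sq_nonneg _)])
  have hσM : σ ^ 2 ≤ M ^ 2 := hvar.trans <| by
    have := integral_mono_ae hi2 (integrable_const (M ^ 2)) hb2
    simpa using this
  have hσM' : σ ≤ M := abs_le_of_sq_le_sq' hσM hM0 |>.2
  have hM : 0 < M := hσ.trans_le hσM'
  have hfrac : σ ^ 2 / (24 * M ^ 2) ≤ 1 / 24 := by
    rw [div_le_div_iff₀ (by positivity) (by norm_num)]; linarith
  have hexp1 : Real.exp (-1) ≤ 1 / 2 := by
    rw [Real.exp_neg, one_div]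
    gcongr
    linarith [Real.add_one_le_exp 1]
  have key : ∀ x : ℝ, σ / 4 ≤ |x| → Real.exp (-x ^ 2 / s ^ 2) ≤ 1 / 2 := by
    intro x hx
    refine (Real.exp_le_exp.2 ?_).trans hexp1
    rw [neg_div, neg_le_neg_iff, one_le_div (by positivity), ← sq_abs x]
    gcongr
    linarith
  rcases le_total |c| (2 * M) with hc | hc
  -- A quadratic majorant replaces Paley–Zygmund: `h ≥ 1` where `|c + ξ| ≤ σ/2`, and `h ≥ 1/2`
  -- elsewhere because `|c + ξ| ≤ 3M`. Its mean involves only the first two moments of `ξ`.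
  · set h : Ω → ℝ := fun ω => 1 - ((c + ξ ω) ^ 2 - σ ^ 2 / 4) / (18 * M ^ 2) with hh
    have hle : ∀ᵐ ω ∂μ, Real.exp (-g ω ^ 2 / s ^ 2) ≤ h ω := by
      filter_upwards [hb, hg] with ω h1 h2
      rcases le_total |c + ξ ω| (σ / 2) with h3 | h3
      · have : Real.exp (-g ω ^ 2 / s ^ 2) ≤ 1 := Real.exp_le_one_iff.2 (by
          rw [neg_div]; exact neg_nonpos.2 (by positivity))
        refine this.trans ?_
        have h4 : (c + ξ ω) ^ 2 ≤ (σ / 2) ^ 2 := by rw [← sq_abs]; gcongr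
        have : ((c + ξ ω) ^ 2 - σ ^ 2 / 4) / (18 * M ^ 2) ≤ 0 :=
          div_nonpos_of_nonpos_of_nonneg (by nlinarith) (by positivity)
        simp only [hh]; linarith
      · refine (key _ ?_).trans ?_
        · have := abs_sub_abs_le_abs_sub (c + ξ ω) (g ω)
          rw [abs_sub_comm] at this
          linarith
        · have h4 : (c + ξ ω) ^ 2 ≤ (3 * M) ^ 2 := by
            rw [← sq_abs]; gcongr
            linarith [abs_add_le c (ξ ω)]
          have : ((c + ξ ω) ^ 2 - σ ^ 2 / 4) / (18 * M ^ 2) ≤ 1 / 2 := by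
            rw [div_le_iff₀ (by positivity)]; nlinarith [sq_nonneg σ]
          simp only [hh]; linarith
    have hint : Integrable h μ := by
      have : h = fun ω => 1 - (c ^ 2 + 2 * c * ξ ω + ξ ω ^ 2 - σ ^ 2 / 4) / (18 * M ^ 2) := by
        funext ω; simp only [hh]; ring
      rw [this]
      exact (integrable_const _).sub
        (((((integrable_const _).add (hi.const_mul _)).add hi2).sub (integrable_const _)).div_const _)
    calc ∫⁻ ω, ENNReal.ofReal (Real.exp (-g ω ^ 2 / s ^ 2)) ∂μ
        ≤ ∫⁻ ω, ENNReal.ofReal (h ω) ∂μ :=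
          lintegral_mono_ae (hle.mono fun ω h => ENNReal.ofReal_le_ofReal h)
      _ = ENNReal.ofReal (∫ ω, h ω ∂μ) :=
          (ofReal_integral_eq_lintegral_ofReal hint
            (hle.mono fun ω h => (Real.exp_pos _).le.trans h)).symm
      _ ≤ _ := ENNReal.ofReal_le_ofReal ?_
    have hcalc : ∫ ω, h ω ∂μ = 1 - (c ^ 2 + ∫ ω, ξ ω ^ 2 ∂μ - σ ^ 2 / 4) / (18 * M ^ 2) := by
      have : h = fun ω => (1 - (c ^ 2 - σ ^ 2 / 4) / (18 * M ^ 2)) +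
          (-(2 * c / (18 * M ^ 2)) * ξ ω + -(1 / (18 * M ^ 2)) * ξ ω ^ 2) := by
        funext ω; simp only [hh]; ring
      have hi12 : Integrable (fun ω => -(2 * c / (18 * M ^ 2)) * ξ ω +
          -(1 / (18 * M ^ 2)) * ξ ω ^ 2) μ := (hi.const_mul _).add (hi2.const_mul _)
      rw [this, integral_add (integrable_const _) hi12,
        integral_add (hi.const_mul _) (hi2.const_mul _), integral_const_mul, integral_const_mul,
        hmean]
      simp; ring
    rw [hcalc]
    have : σ ^ 2 / (24 * M ^ 2) = (3 / 4 * σ ^ 2) / (18 * M ^ 2) := by field_simp; norm_num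
    rw [this]
    gcongr
    nlinarith [sq_nonneg c]
  -- A shift of size at least `2M` cannot be cancelled by `ξ`, so the bound is pointwise.
  · calc ∫⁻ ω, ENNReal.ofReal (Real.exp (-g ω ^ 2 / s ^ 2)) ∂μ
        ≤ ∫⁻ _, ENNReal.ofReal (1 - σ ^ 2 / (24 * M ^ 2)) ∂μ := by
          refine lintegral_mono_ae ?_
          filter_upwards [hb, hg] with ω h1 h2
          refine ENNReal.ofReal_le_ofReal ((key _ ?_).trans (by linarith))
          have h3 := abs_sub_abs_le_abs_sub (c + ξ ω) (g ω)
          rw [abs_sub_comm] at h3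
          have h4 := abs_sub_abs_le_abs_sub c (-ξ ω)
          rw [abs_neg, sub_neg_eq_add] at h4
          linarith
      _ = _ := by simp

end smallBall

/-! ### Moments of the noise -/

section noise

variable {Ω : Type*} [MeasurableSpace Ω] {μ : Measure Ω} {d : ℕ}
  {ξ : ℕ → Ω → E d} {r σ : ℝ}

lemma IsNoise.abs_inner_le (h : IsNoise μ ξ r σ) (a : E d) (t : ℕ) :
    ∀ᵐ ω ∂μ, |inner ℝ a (ξ t ω)| ≤ ‖a‖ * r :=
  (h.bdd t).mono fun ω hω => (abs_real_inner_le_norm _ _).trans (by gcongr)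

variable [IsProbabilityMeasure μ]

lemma IsNoise.nonneg (h : IsNoise μ ξ r σ) : 0 ≤ r := by
  obtain ⟨ω, hω⟩ := (h.bdd 0).exists
  exact (norm_nonneg _).trans hω

lemma IsNoise.integrable (h : IsNoise μ ξ r σ) (t : ℕ) : Integrable (ξ t) μ :=
  Integrable.of_bound (h.meas t).aestronglyMeasurable r (h.bdd t)

lemma IsNoise.integral_inner (h : IsNoise μ ξ r σ) (a : E d) (t : ℕ) :
    ∫ ω, inner ℝ a (ξ t ω) ∂μ = 0 := by
  rw [_root_.integral_inner (h.integrable t), h.mean t, inner_zero_right]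

lemma IsNoise.memLp_apply (h : IsNoise μ ξ r σ) (t : ℕ) (i : Fin d) :
    MemLp (fun ω => ξ t ω i) 2 μ := by
  refine MemLp.of_bound ?_ r ((h.bdd t).mono fun ω hω => (PiLp.norm_apply_le _ i).trans hω)
  exact ((EuclideanSpace.proj i : E d →L[ℝ] ℝ).continuous.measurable.comp
    (h.meas t)).aestronglyMeasurable

/-- The second moment of the noise in every direction is bounded below. -/
lemma IsNoise.le_integral_inner_sq (h : IsNoise μ ξ r σ) (a : E d) (t : ℕ) :
    σ ^ 2 * ‖a‖ ^ 2 ≤ ∫ ω, inner ℝ a (ξ t ω) ^ 2 ∂μ := by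
  have h1 := (h.cov t).dotProduct_mulVec_nonneg (a : Fin d → ℝ)
  have hin : ∀ ω, inner ℝ a (ξ t ω) = ∑ i, a i * ξ t ω i := fun ω => by
    simp [PiLp.inner_apply, mul_comm]
  have hm : MemLp (fun ω => inner ℝ a (ξ t ω)) 2 μ := by
    refine MemLp.of_bound ?_ _ (h.abs_inner_le a t)
    exact (measurable_const.inner (h.meas t)).aestronglyMeasurable
  have h2 : ∫ ω, inner ℝ a (ξ t ω) ^ 2 ∂μ =
      cov[fun ω => ∑ i, a i * ξ t ω i, fun ω => ∑ i, a i * ξ t ω i; μ] := by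
    rw [← funext hin, covariance_eq_sub hm hm, h.integral_inner a t]
    simp [sq]
  rw [h2, covariance_fun_sum_fun_sum (fun i => (h.memLp_apply t i).const_mul _)
    (fun i => (h.memLp_apply t i).const_mul _)]
  simp only [covariance_const_mul_left, covariance_const_mul_right]
  have h3 : ‖a‖ ^ 2 = ∑ i, a i * a i := by
    rw [EuclideanSpace.real_norm_sq_eq]; simp [sq]
  rw [h3]
  simp only [Matrix.sub_mulVec, Matrix.smul_mulVec, Matrix.one_mulVec, dotProduct_sub,
    dotProduct_smul, star_trivial, smul_eq_mul] at h1
  simp only [dotProduct, Matrix.mulVec, covMatrix, Matrix.of_apply] at h1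
  have h4 : ∑ i, a i * ∑ j, cov[fun ω => ξ t ω i, fun ω => ξ t ω j; μ] * a j =
      ∑ i, ∑ j, a j * (a i * cov[fun ω => ξ t ω i, fun ω => ξ t ω j; μ]) := by
    simp only [Finset.mul_sum]
    exact Finset.sum_congr rfl fun i _ => Finset.sum_congr rfl fun j _ => by ring
  rw [h4] at h1
  refine (sub_nonneg.1 h1).trans (le_of_eq ?_)
  exact Finset.sum_congr rfl fun i _ => Finset.sum_congr rfl fun j _ => by ring

/-- The trace of the covariance is at least `d σ²` and equals `E‖ξ‖² ≤ r²`. Hence dimensions are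
bounded by squared noise ratios. -/
lemma IsNoise.card_mul_sq_le (h : IsNoise μ ξ r σ) : d * σ ^ 2 ≤ r ^ 2 := by
  have h1 : ∀ i : Fin d, σ ^ 2 ≤ ∫ ω, ξ 0 ω i ^ 2 ∂μ := fun i => by
    simpa [EuclideanSpace.inner_single_left] using
      h.le_integral_inner_sq (EuclideanSpace.single i 1) 0
  have h2 : ∑ i : Fin d, ∫ ω, ξ 0 ω i ^ 2 ∂μ ≤ r ^ 2 := by
    rw [← integral_finsetSum _ fun i _ => (h.memLp_apply 0 i).integrable_sq]
    have := integral_mono_ae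
      (integrable_finsetSum Finset.univ fun i _ => (h.memLp_apply 0 i).integrable_sq)
      (integrable_const (r ^ 2)) ((h.bdd 0).mono fun ω hω => by
        have : ‖ξ 0 ω‖ ^ 2 ≤ r ^ 2 := by gcongr
        rwa [EuclideanSpace.real_norm_sq_eq] at this)
    simpa using this
  calc (d : ℝ) * σ ^ 2 = ∑ _i : Fin d, σ ^ 2 := by simp
    _ ≤ _ := (Finset.sum_le_sum fun i _ => h1 i).trans h2

/-- Hoeffding's lemma for a coordinate of the noise. -/
lemma IsNoise.lintegral_exp_le (h : IsNoise μ ξ r σ) (t : ℕ) (i : Fin d) (x : ℝ) :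
    ∫⁻ ω, ENNReal.ofReal (Real.exp (ξ t ω i * x - r ^ 2 / 2 * x ^ 2)) ∂μ ≤ 1 := by
  have h0 : ∫ ω, ξ t ω i ∂μ = 0 := by
    simpa [EuclideanSpace.inner_single_left] using
      h.integral_inner (EuclideanSpace.single i 1) t
  have hsub := hasSubgaussianMGF_of_mem_Icc_of_integral_eq_zero (a := -r) (b := r)
    (h.memLp_apply t i).1.aemeasurable
    ((h.bdd t).mono fun ω hω => abs_le.1 ((PiLp.norm_apply_le (ξ t ω) i).trans hω)) h0
  have hc : (((‖r - -r‖₊ / 2) ^ 2 : NNReal) : ℝ) = r ^ 2 := by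
    push_cast
    rw [sub_neg_eq_add, Real.norm_of_nonneg (by linarith [h.nonneg])]
    ring
  have h1 := hsub.mgf_le x
  rw [hc] at h1
  have h2 := hsub.integrable_exp_mul x
  have h3 : ∀ ω, Real.exp (ξ t ω i * x - r ^ 2 / 2 * x ^ 2) =
      Real.exp (-(r ^ 2 * x ^ 2 / 2)) * Real.exp (x * ξ t ω i) := fun ω => by
    rw [← Real.exp_add]; congr 1; ring
  simp only [h3]
  rw [← ofReal_integral_eq_lintegral_ofReal (h2.const_mul _)
    (Filter.Eventually.of_forall fun ω => by positivity), integral_const_mul,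
    ← ENNReal.ofReal_one]
  refine ENNReal.ofReal_le_ofReal ?_
  calc _ ≤ Real.exp (-(r ^ 2 * x ^ 2 / 2)) * Real.exp (r ^ 2 * x ^ 2 / 2) := by
        gcongr; exact h1
    _ = 1 := by rw [← Real.exp_add]; simp

end noise

/-! ### Independence of the past and fresh noise -/

section independence

variable {Ω : Type*} [MeasurableSpace Ω] {μ : Measure Ω} [IsProbabilityMeasure μ]

/-- Two independent pairs, each with independent entries, can be regrouped. -/
lemma IndepFun.regroup {α₁ α₂ β₁ β₂ : Type*} [MeasurableSpace α₁] [MeasurableSpace α₂]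
    [MeasurableSpace β₁] [MeasurableSpace β₂] {W₁ : Ω → α₁} {W₂ : Ω → α₂} {H₁ : Ω → β₁}
    {H₂ : Ω → β₂} (mW₁ : Measurable W₁) (mW₂ : Measurable W₂) (mH₁ : Measurable H₁)
    (mH₂ : Measurable H₂) (hW : IndepFun W₁ W₂ μ) (hH : IndepFun H₁ H₂ μ)
    (h : IndepFun (fun ω => (W₁ ω, W₂ ω)) (fun ω => (H₁ ω, H₂ ω)) μ) :
    IndepFun (fun ω => (W₁ ω, H₁ ω)) (fun ω => (W₂ ω, H₂ ω)) μ := by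
  have h11 : IndepFun W₁ H₁ μ := h.comp measurable_fst measurable_fst
  have h22 : IndepFun W₂ H₂ μ := h.comp measurable_snd measurable_snd
  rw [IndepFun_iff_Indep, ← generateFrom_prod, ← generateFrom_prod,
    MeasurableSpace.comap_generateFrom, MeasurableSpace.comap_generateFrom]
  refine IndepSets.indep' ?_ ?_ (isPiSystem_prod.comap _) (isPiSystem_prod.comap _) ?_
  · rintro _ ⟨_, ⟨A, hA, B, hB, rfl⟩, rfl⟩
    exact (mW₁.prodMk mH₁) (MeasurableSet.prod hA hB)
  · rintro _ ⟨_, ⟨A, hA, B, hB, rfl⟩, rfl⟩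
    exact (mW₂.prodMk mH₂) (MeasurableSet.prod hA hB)
  · rw [IndepSets_iff]
    rintro _ _ ⟨_, ⟨A, hA, B, hB, rfl⟩, rfl⟩ ⟨_, ⟨C, hC, D, hD, rfl⟩, rfl⟩
    have e1 : (fun ω => (W₁ ω, H₁ ω)) ⁻¹' (A ×ˢ B) ∩ (fun ω => (W₂ ω, H₂ ω)) ⁻¹' (C ×ˢ D) =
        (fun ω => (W₁ ω, W₂ ω)) ⁻¹' (A ×ˢ C) ∩ (fun ω => (H₁ ω, H₂ ω)) ⁻¹' (B ×ˢ D) := by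
      ext ω; simp only [Set.mem_inter_iff, Set.mem_preimage, Set.mem_prod]; tauto
    rw [e1, h.measure_inter_preimage_eq_mul _ _ (MeasurableSet.prod hA hC)
      (MeasurableSet.prod hB hD)]
    simp only [Set.mk_preimage_prod]
    rw [hW.measure_inter_preimage_eq_mul _ _ hA hC, hH.measure_inter_preimage_eq_mul _ _ hB hD,
      h11.measure_inter_preimage_eq_mul _ _ hA hB, h22.measure_inter_preimage_eq_mul _ _ hC hD]
    ring

/-- A conditional bound, given the past `X`, on a function of `X` and of fresh noise `Y`. -/
lemma lintegral_mul_le_of_indepFun {α β : Type*} [MeasurableSpace α] [MeasurableSpace β]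
    {X : Ω → α} {Y : Ω → β} (hX : Measurable X) (hY : Measurable Y) (h : IndepFun X Y μ)
    {H : α → ℝ≥0∞} (hH : Measurable H) {K : α → β → ℝ≥0∞} (hK : Measurable (Function.uncurry K))
    {k : ℝ≥0∞} (hk : ∀ x, ∫⁻ y, K x y ∂(μ.map Y) ≤ k) :
    ∫⁻ ω, H (X ω) * K (X ω) (Y ω) ∂μ ≤ k * ∫⁻ ω, H (X ω) ∂μ := by
  have hm : Measurable fun p : α × β => H p.1 * K p.1 p.2 := (hH.comp measurable_fst).mul hK
  have : IsProbabilityMeasure (μ.map Y) := Measure.isProbabilityMeasure_map hY.aemeasurable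
  calc ∫⁻ ω, H (X ω) * K (X ω) (Y ω) ∂μ
      = ∫⁻ p, H p.1 * K p.1 p.2 ∂(μ.map fun ω => (X ω, Y ω)) :=
        (lintegral_map hm (hX.prodMk hY)).symm
    _ = ∫⁻ x, ∫⁻ y, H x * K x y ∂(μ.map Y) ∂(μ.map X) := by
        rw [h.map_prod_eq_prod_map_map hX.aemeasurable hY.aemeasurable,
          lintegral_prod _ hm.aemeasurable]
    _ = ∫⁻ x, H x * ∫⁻ y, K x y ∂(μ.map Y) ∂(μ.map X) := by
        congr 1; funext x
        exact lintegral_const_mul _ (hK.comp measurable_prodMk_left)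
    _ ≤ ∫⁻ x, H x * k ∂(μ.map X) := by gcongr with x; exact hk x
    _ = k * ∫⁻ ω, H (X ω) ∂μ := by
        rw [lintegral_mul_const _ hH, lintegral_map hH hX, mul_comm]

end independence

/-! ### Exponential moments along the trajectory -/

section trajectory

variable {Ω : Type*} {n m : ℕ}

lemma measurable_pair {α : Type*} [MeasurableSpace α] {f : α → E n} {g : α → E m}
    (hf : Measurable f) (hg : Measurable g) : Measurable fun a => pair (f a) (g a) :=
  (WithLp.measurable_toLp 2 _).comp (hf.prodMk hg)

lemma inner_pair (c : Z n m) (x : E n) (u : E m) :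
    inner ℝ c (pair x u) = inner ℝ c.fst x + inner ℝ c.snd u := by
  rw [WithLp.prod_inner_apply]; rfl

lemma norm_pair (x : E n) (u : E m) : ‖pair x u‖ = √(‖x‖ ^ 2 + ‖u‖ ^ 2) := by
  rw [WithLp.prod_norm_eq_of_L2]; rfl

lemma pair_add_pair (x x' : E n) (u u' : E m) :
    pair x u + pair x' u' = pair (x + x') (u + u') := rfl

/-- The state at time `t` only depends on the noise before time `t`. -/
lemma measurable_state [MeasurableSpace Ω] {θ : Param n m} {π : E n → E m} (hπ : Measurable π)
    (x₀ : E n) {w : ℕ → Ω → E n} {η : ℕ → Ω → E m} :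
    ∀ t, (∀ j < t, Measurable (w j)) → (∀ j < t, Measurable (η j)) →
      Measurable (state θ π x₀ w η t)
  | 0, _, _ => measurable_const
  | t + 1, hw, hη => by
    have h := measurable_state hπ (θ := θ) x₀ t (fun j hj => hw j (by omega))
      fun j hj => hη j (by omega)
    exact (θ.continuous.measurable.comp (measurable_pair h ((hπ.comp h).add
      (hη t (by omega))))).add (hw t (by omega))

lemma measurable_stacked [MeasurableSpace Ω] {θ : Param n m} {π : E n → E m} (hπ : Measurable π)
    (x₀ : E n) {w : ℕ → Ω → E n} {η : ℕ → Ω → E m} (t : ℕ) (hw : ∀ j < t, Measurable (w j))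
    (hη : ∀ j ≤ t, Measurable (η j)) : Measurable (stacked θ π x₀ w η t) := by
  have h := measurable_state hπ (θ := θ) x₀ t hw fun j hj => hη j hj.le
  exact measurable_pair h ((hπ.comp h).add (hη t le_rfl))

variable [MeasurableSpace Ω] {μ : Measure Ω} [IsProbabilityMeasure μ]
  {w : ℕ → Ω → E n} {η : ℕ → Ω → E m} {ρw ρη σw ση : ℝ}

/-- Whatever is measurable with respect to `w 0, …, w (s - 1), η 0, …, η s` is independent of
`(w s, η (s + 1))`. -/
lemma indepFun_past (hw : IsNoise μ w ρw σw) (hη : IsNoise μ η ρη ση)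
    (hwη : IndepFun (fun ω t => w t ω) (fun ω t => η t ω) μ) (s : ℕ) {α : Type*}
    [MeasurableSpace α] {X : Ω → α}
    (hX : ∀ m' : MeasurableSpace Ω, (∀ j < s, Measurable[m'] (w j)) →
      (∀ j ≤ s, Measurable[m'] (η j)) → Measurable[m'] X) :
    IndepFun X (fun ω => (w s ω, η (s + 1) ω)) μ := by
  set W : Ω → Finset.range s → E n := fun ω i => w i ω with hW
  set H : Ω → Finset.range (s + 1) → E m := fun ω i => η i ω with hH
  have mW : Measurable W := measurable_pi_lambda _ fun i => hw.meas i
  have mH : Measurable H := measurable_pi_lambda _ fun i => hη.meas i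
  have iW : IndepFun W (w s) μ :=
    (hw.indep.indepFun_finset (Finset.range s) {s} (by simp) hw.meas).comp measurable_id
      (measurable_pi_apply (⟨s, by simp⟩ : ({s} : Finset ℕ)))
  have iH : IndepFun H (η (s + 1)) μ :=
    (hη.indep.indepFun_finset (Finset.range (s + 1)) {s + 1} (by simp) hη.meas).comp
      measurable_id (measurable_pi_apply (⟨s + 1, by simp⟩ : ({s + 1} : Finset ℕ)))
  have iWH : IndepFun (fun ω => (W ω, w s ω)) (fun ω => (H ω, η (s + 1) ω)) μ :=
    hwη.comp (φ := fun f => ((fun i => f i : Finset.range s → E n), f s))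
      (ψ := fun f => ((fun i => f i : Finset.range (s + 1) → E m), f (s + 1)))
      (by fun_prop) (by fun_prop)
  have key := IndepFun.regroup mW (hw.meas s) mH (hη.meas (s + 1)) iW iH iWH
  rw [IndepFun_iff_Indep] at key ⊢
  -- The hypothesis `hX` is instantiated at the σ-algebra generated by the finite past `(W, H)`, so
  -- `X` need not be factored explicitly through it.
  refine indep_of_indep_of_le_left key (Measurable.comap_le ?_)
  have h0 : Measurable[MeasurableSpace.comap (fun ω => (W ω, H ω)) inferInstance]
      (fun ω => (W ω, H ω)) := comap_measurable _
  refine hX _ (fun j hj => ?_) fun j hj => ?_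
  · exact (measurable_pi_apply (⟨j, by simpa using hj⟩ : Finset.range s)).comp
      (measurable_fst.comp h0)
  · exact (measurable_pi_apply (⟨j, by simpa using Nat.lt_succ_of_le hj⟩ :
      Finset.range (s + 1))).comp (measurable_snd.comp h0)

/-- Small-ball estimate for `(x + w, π (x + w) + η)`, in exponential form. -/
lemma lintegral_exp_neg_inner_pair_le (hw : IsNoise μ w ρw σw) (hη : IsNoise μ η ρη ση)
    {π : E n → E m} (hπ : Measurable π) {b s p : ℝ} (hπb : ∀ x, ‖π x‖ ≤ b) (hρη : ρη ≤ b)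
    (hσw : σw ≤ b) (hση : ση ≤ b) (hs : s = σw * ση / (64 * b))
    (hpw : p ≤ σw ^ 2 / (24 * ρw ^ 2)) (hpη : p ≤ ση ^ 2 / (24 * ρη ^ 2)) (x : E n) {c : Z n m}
    (hc : 1 ≤ ‖c‖) (t t' : ℕ) :
    ∫⁻ y, ENNReal.ofReal (Real.exp (-inner ℝ c (pair (x + y.1) (π (x + y.1) + y.2)) ^ 2 / s ^ 2))
      ∂((μ.map (w t)).prod (μ.map (η t'))) ≤ ENNReal.ofReal (1 - p) := by
  have hσw0 := hw.pos
  have hση0 := hη.pos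
  have hb : 0 < b := hσw0.trans_le hσw
  have hs0 : 0 < s := by rw [hs]; positivity
  have : IsProbabilityMeasure (μ.map (w t)) :=
    Measure.isProbabilityMeasure_map (hw.meas t).aemeasurable
  have : IsProbabilityMeasure (μ.map (η t')) :=
    Measure.isProbabilityMeasure_map (hη.meas t').aemeasurable
  have hm : Measurable fun y : E n × E m => ENNReal.ofReal
      (Real.exp (-inner ℝ c (pair (x + y.1) (π (x + y.1) + y.2)) ^ 2 / s ^ 2)) := by
    have h1 : Measurable fun y : E n × E m => x + y.1 := measurable_const.add measurable_fst
    exact ENNReal.measurable_ofReal.comp (Real.measurable_exp.comp (((measurable_const.inner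
      (measurable_pair h1 ((hπ.comp h1).add measurable_snd))).pow_const 2).neg.div_const _))
  -- At this threshold `ση * ‖c.snd‖ / 4` is at least `s`. Below it, `|⟨c.snd, u⟩| ≤ 2b ‖c.snd‖ ≤ σw
  -- / 8` for every input `u` of the policy plus excitation.
  by_cases hcb : σw / (16 * b) ≤ ‖c.snd‖
  · have hc0 : 0 < ‖c.snd‖ := (by positivity : 0 < σw / (16 * b)).trans_le hcb
    rw [lintegral_prod _ hm.aemeasurable]
    calc _ ≤ ∫⁻ _, ENNReal.ofReal (1 - p) ∂(μ.map (w t)) := lintegral_mono fun y => ?_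
      _ = _ := by simp
    have hmy : Measurable fun u : E m => ENNReal.ofReal
        (Real.exp (-inner ℝ c (pair (x + y) (π (x + y) + u)) ^ 2 / s ^ 2)) := by
      have h1 : Measurable (Prod.mk y : E m → E n × E m) := measurable_prodMk_left
      have h2 := hm.comp h1
      exact h2
    dsimp only
    rw [lintegral_map hmy (hη.meas t')]
    refine (lintegral_exp_neg_sq_le (ξ := fun ω => inner ℝ c.snd (η t' ω))
      (σ := ση * ‖c.snd‖) (M := ‖c.snd‖ * ρη)
      (c := inner ℝ c.fst (x + y) + inner ℝ c.snd (π (x + y)))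
      (measurable_const.inner (hη.meas t')) (by positivity) (hη.integral_inner _ _)
      ((mul_pow _ _ _).trans_le (hη.le_integral_inner_sq _ _)) (hη.abs_inner_le _ _) hs0 ?_
      (Filter.Eventually.of_forall fun ω => ?_)).trans (ENNReal.ofReal_le_ofReal ?_)
    · have : ση * (σw / (16 * b)) ≤ ση * ‖c.snd‖ := by gcongr
      rw [hs]
      calc σw * ση / (64 * b) = ση * (σw / (16 * b)) / 4 := by field_simp; norm_num
        _ ≤ _ := by linarith
    · rw [inner_pair, inner_add_right, inner_add_right]
      have : inner ℝ c.fst x + inner ℝ c.fst y + (inner ℝ c.snd (π (x + y)) +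
        inner ℝ c.snd (η t' ω)) - (inner ℝ c.fst x + inner ℝ c.fst y + inner ℝ c.snd (π (x + y))
        + inner ℝ c.snd (η t' ω)) = 0 := by ring
      rw [this, abs_zero]; positivity
    · have : (ση * ‖c.snd‖) ^ 2 / (24 * (‖c.snd‖ * ρη) ^ 2) = ση ^ 2 / (24 * ρη ^ 2) := by
        rw [mul_pow, mul_pow, mul_comm (ση ^ 2), mul_left_comm, mul_div_mul_left _ _ (by positivity)]
      rw [this]; linarith
  · push Not at hcb
    have hcb16 : ‖c.snd‖ ≤ 1 / 16 := hcb.le.trans (by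
      rw [div_le_div_iff₀ (by positivity) (by norm_num)]; linarith)
    have hca : 1 / 2 ≤ ‖c.fst‖ := by
      have h1 := WithLp.prod_norm_sq_eq_of_L2 c
      by_contra h2
      push Not at h2
      nlinarith [norm_nonneg c.fst, norm_nonneg c.snd]
    -- The excitation is frozen and `w` is averaged. The input depends on `w` through `π`, so it
    -- belongs to the perturbation rather than to the shift.
    rw [lintegral_prod_symm _ hm.aemeasurable]
    calc _ ≤ ∫⁻ _, ENNReal.ofReal (1 - p) ∂(μ.map (η t')) := lintegral_mono_ae ?_
      _ = _ := by simp
    have hbd : ∀ᵐ y ∂(μ.map (η t')), ‖y‖ ≤ ρη :=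
      (ae_map_iff (hη.meas t').aemeasurable
        (measurableSet_le measurable_norm measurable_const)).2 (hη.bdd t')
    filter_upwards [hbd] with y hy
    have hmy : Measurable fun v : E n => ENNReal.ofReal
        (Real.exp (-inner ℝ c (pair (x + v) (π (x + v) + y)) ^ 2 / s ^ 2)) := by
      have h1 : Measurable (fun v : E n => (v, y)) := measurable_prodMk_right
      have h2 := hm.comp h1
      exact h2
    rw [lintegral_map hmy (hw.meas t)]
    refine (lintegral_exp_neg_sq_le (ξ := fun ω => inner ℝ c.fst (w t ω))
      (σ := σw * ‖c.fst‖) (M := ‖c.fst‖ * ρw)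
      (c := inner ℝ c.fst x)
      (measurable_const.inner (hw.meas t)) (by positivity) (hw.integral_inner _ _)
      ((mul_pow _ _ _).trans_le (hw.le_integral_inner_sq _ _)) (hw.abs_inner_le _ _) hs0 ?_
      (Filter.Eventually.of_forall fun ω => ?_)).trans (ENNReal.ofReal_le_ofReal ?_)
    · have h1 : σw * ση ≤ σw * b := by gcongr
      have h2 : σw * (1 / 2) ≤ σw * ‖c.fst‖ := by gcongr
      have h3 : s ≤ σw / 64 := by
        rw [hs, div_le_div_iff₀ (by positivity) (by norm_num)]; linarith
      linarith
    · rw [inner_pair, inner_add_right]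
      have h0 : inner ℝ c.fst x + inner ℝ c.fst (w t ω) + inner ℝ c.snd (π (x + w t ω) + y) -
          (inner ℝ c.fst x + inner ℝ c.fst (w t ω)) = inner ℝ c.snd (π (x + w t ω) + y) := by ring
      rw [h0]
      calc _ ≤ ‖c.snd‖ * ‖π (x + w t ω) + y‖ := abs_real_inner_le_norm _ _
        _ ≤ σw / (16 * b) * (b + b) := by
          gcongr
          exact (norm_add_le _ _).trans (add_le_add (hπb _) (hy.trans hρη))
        _ = σw * (1 / 2) / 4 := by field_simp; norm_num
        _ ≤ _ := by gcongr
    · have : (σw * ‖c.fst‖) ^ 2 / (24 * (‖c.fst‖ * ρw) ^ 2) = σw ^ 2 / (24 * ρw ^ 2) := by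
        rw [mul_pow, mul_pow, mul_comm (σw ^ 2), mul_left_comm, mul_div_mul_left _ _ (by positivity)]
      rw [this]; linarith

lemma map_noise_prod (hw : IsNoise μ w ρw σw) (hη : IsNoise μ η ρη ση)
    (hwη : IndepFun (fun ω t => w t ω) (fun ω t => η t ω) μ) (s t : ℕ) :
    μ.map (fun ω => (w s ω, η t ω)) = (μ.map (w s)).prod (μ.map (η t)) := by
  have h : IndepFun (w s) (η t) μ :=
    hwη.comp (φ := fun f : ℕ → E n => f s) (ψ := fun f : ℕ → E m => f t)
      (measurable_pi_apply s) (measurable_pi_apply t)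
  exact h.map_prod_eq_prod_map_map (hw.meas s).aemeasurable (hη.meas t).aemeasurable

/-- Exponential moments of the Gram form of the trajectory. -/
lemma lintegral_exp_neg_gram_le (hw : IsNoise μ w ρw σw) (hη : IsNoise μ η ρη ση)
    (hwη : IndepFun (fun ω t => w t ω) (fun ω t => η t ω) μ) (θ : Param n m)
    {π : E n → E m} (hπ : Measurable π) (x₀ : E n) {b s p : ℝ} (hπb : ∀ x, ‖π x‖ ≤ b)
    (hρη : ρη ≤ b) (hσw : σw ≤ b) (hση : ση ≤ b) (hs : s = σw * ση / (64 * b))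
    (hpw : p ≤ σw ^ 2 / (24 * ρw ^ 2)) (hpη : p ≤ ση ^ 2 / (24 * ρη ^ 2)) {c : Z n m}
    (hc : 1 ≤ ‖c‖) (T : ℕ) :
    ∫⁻ ω, ENNReal.ofReal (Real.exp (-(∑ t ∈ Finset.range (T + 1),
      inner ℝ c (stacked θ π x₀ w η t ω) ^ 2) / s ^ 2)) ∂μ ≤
      ENNReal.ofReal (Real.exp (-(p * T))) := by
  induction T with
  | zero =>
    -- The initial state is deterministic, so `z_0` is not used for excitation: `T + 1` samples
    -- yield only `T` factors.
    calc _ ≤ ∫⁻ _, 1 ∂μ := lintegral_mono fun ω => by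
          rw [← ENNReal.ofReal_one]
          refine ENNReal.ofReal_le_ofReal (Real.exp_le_one_iff.2 ?_)
          rw [neg_div]; exact neg_nonpos.2 (by positivity)
      _ ≤ _ := by simp
  | succ T ih =>
    set z := stacked θ π x₀ w η with hz
    have hq : ∀ m' : MeasurableSpace Ω, (∀ j < T, Measurable[m'] (w j)) →
        (∀ j ≤ T, Measurable[m'] (η j)) → Measurable[m']
        (fun ω => (z T ω, ∑ t ∈ Finset.range (T + 1), inner ℝ c (z t ω) ^ 2)) := by
      intro m' h1 h2
      have hzt : ∀ t ≤ T, Measurable[m'] (z t) := fun t ht =>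
        @measurable_stacked _ _ _ m' _ _ hπ x₀ _ _ t (fun j hj => h1 j (by omega))
          fun j hj => h2 j (by omega)
      refine (hzt T le_rfl).prodMk (Finset.measurable_sum _ fun t ht => ?_)
      exact (measurable_const.inner (hzt t (Nat.lt_succ_iff.1 (Finset.mem_range.1 ht)))).pow_const 2
    have hstep : ∀ ω, Real.exp (-(∑ t ∈ Finset.range (T + 1 + 1), inner ℝ c (z t ω) ^ 2) / s ^ 2) =
        Real.exp (-(∑ t ∈ Finset.range (T + 1), inner ℝ c (z t ω) ^ 2) / s ^ 2) *
        Real.exp (-inner ℝ c (pair (θ (z T ω) + w T ω) (π (θ (z T ω) + w T ω) + η (T + 1) ω)) ^ 2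
          / s ^ 2) := fun ω => by
      rw [Finset.sum_range_succ _ (T + 1), neg_add, add_div, Real.exp_add]; rfl
    have hmx : Measurable fun q : (Z n m × ℝ) × (E n × E m) => θ q.1.1 + q.2.1 :=
      (θ.continuous.measurable.comp (measurable_fst.comp measurable_fst)).add
        (measurable_fst.comp measurable_snd)
    have key := lintegral_mul_le_of_indepFun (k := ENNReal.ofReal (1 - p))
      (hq _ (fun j _ => hw.meas j) fun j _ => hη.meas j)
      ((hw.meas T).prodMk (hη.meas (T + 1))) (indepFun_past hw hη hwη T hq)
      (H := fun x => ENNReal.ofReal (Real.exp (-x.2 / s ^ 2)))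
      (K := fun x y => ENNReal.ofReal (Real.exp
        (-inner ℝ c (pair (θ x.1 + y.1) (π (θ x.1 + y.1) + y.2)) ^ 2 / s ^ 2)))
      (ENNReal.measurable_ofReal.comp (Real.measurable_exp.comp (measurable_snd.neg.div_const _)))
      (ENNReal.measurable_ofReal.comp (Real.measurable_exp.comp (((measurable_const.inner
        (measurable_pair hmx ((hπ.comp hmx).add
          (measurable_snd.comp measurable_snd)))).pow_const 2).neg.div_const _)))
      (fun x => by
        rw [map_noise_prod hw hη hwη]
        exact lintegral_exp_neg_inner_pair_le hw hη hπ hπb hρη hσw hση hs hpw hpη _ hc _ _)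
    simp only [hstep, ENNReal.ofReal_mul (Real.exp_pos _).le]
    refine key.trans ((mul_le_mul_right ih _).trans ?_)
    rw [← ENNReal.ofReal_mul' (Real.exp_pos _).le]
    refine ENNReal.ofReal_le_ofReal ?_
    calc (1 - p) * Real.exp (-(p * T)) ≤ Real.exp (-p) * Real.exp (-(p * T)) := by
          gcongr; linarith [Real.add_one_le_exp (-p)]
      _ = _ := by rw [← Real.exp_add]; push_cast; ring_nf

/-- The exponential supermartingale for the cross terms of noise coordinate `i` and trajectory. -/
lemma lintegral_exp_cross_le (hw : IsNoise μ w ρw σw) (hη : IsNoise μ η ρη ση)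
    (hwη : IndepFun (fun ω t => w t ω) (fun ω t => η t ω) μ) (θ : Param n m)
    {π : E n → E m} (hπ : Measurable π) (x₀ : E n) (i : Fin n) (a : Z n m) (T : ℕ) :
    ∫⁻ ω, ENNReal.ofReal (Real.exp (∑ t ∈ Finset.range T,
      (w t ω i * inner ℝ a (stacked θ π x₀ w η t ω) -
        ρw ^ 2 / 2 * inner ℝ a (stacked θ π x₀ w η t ω) ^ 2))) ∂μ ≤ 1 := by
  induction T with
  | zero => simp
  | succ T ih =>
    set z := stacked θ π x₀ w η with hz
    have hi : Measurable fun y : E n => y i :=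
      (EuclideanSpace.proj i : E n →L[ℝ] ℝ).continuous.measurable
    have hq : ∀ m' : MeasurableSpace Ω, (∀ j < T, Measurable[m'] (w j)) →
        (∀ j ≤ T, Measurable[m'] (η j)) → Measurable[m']
        (fun ω => (z T ω, ∑ t ∈ Finset.range T, (w t ω i * inner ℝ a (z t ω) -
          ρw ^ 2 / 2 * inner ℝ a (z t ω) ^ 2))) := by
      intro m' h1 h2
      have hzt : ∀ t ≤ T, Measurable[m'] (z t) := fun t ht =>
        @measurable_stacked _ _ _ m' _ _ hπ x₀ _ _ t (fun j hj => h1 j (by omega))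
          fun j hj => h2 j (by omega)
      refine (hzt T le_rfl).prodMk (Finset.measurable_sum _ fun t ht => ?_)
      have ht' := Finset.mem_range.1 ht
      have h3 : Measurable[m'] fun ω => inner ℝ a (z t ω) := measurable_const.inner (hzt t ht'.le)
      exact ((hi.comp (h1 t ht')).mul h3).sub ((h3.pow_const 2).const_mul _)
    have hind : IndepFun _ (w T) μ :=
      (indepFun_past hw hη hwη T hq).comp measurable_id measurable_fst
    have hmi : Measurable fun q : (Z n m × ℝ) × E n => inner ℝ a q.1.1 :=
      measurable_const.inner (measurable_fst.comp measurable_fst)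
    have hKm : Measurable (Function.uncurry fun (x : Z n m × ℝ) (y : E n) => ENNReal.ofReal
        (Real.exp (y i * inner ℝ a x.1 - ρw ^ 2 / 2 * inner ℝ a x.1 ^ 2))) :=
      ENNReal.measurable_ofReal.comp (Real.measurable_exp.comp
        (((hi.comp measurable_snd).mul hmi).sub ((hmi.pow_const 2).const_mul _)))
    have key := lintegral_mul_le_of_indepFun (k := 1)
      (hq _ (fun j _ => hw.meas j) fun j _ => hη.meas j) (hw.meas T) hind
      (H := fun x => ENNReal.ofReal (Real.exp x.2))
      (ENNReal.measurable_ofReal.comp (Real.measurable_exp.comp measurable_snd)) hKm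
      (fun x => by
        have hmy : Measurable fun y : E n => ENNReal.ofReal
          (Real.exp (y i * inner ℝ a x.1 - ρw ^ 2 / 2 * inner ℝ a x.1 ^ 2)) :=
          hKm.comp measurable_prodMk_left
        rw [lintegral_map hmy (hw.meas T)]
        exact hw.lintegral_exp_le T i _)
    simp only [Finset.sum_range_succ, Real.exp_add, ENNReal.ofReal_mul (Real.exp_pos _).le]
    exact key.trans (by simpa using ih)

end trajectory

/-! ### Tubes, tightened constraints and recursive feasibility -/

namespace Design

variable {n m : ℕ} {D : Design n m}

lemma AK_apply (e : E n) : D.AK e = D.θ₀ (pair e (D.K e)) := rfl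

lemma mem_lumpedExcitedSet {x : E n} {u : E m} {θ : Param n m} {w : E n} {η : E m}
    (hx : x ∈ D.X) (hu : u ∈ D.U) (hθ : θ ∈ D.Θ₀) (hw : ‖w‖ ≤ D.wmax) (hη : ‖η‖ ≤ D.ηmax) :
    w + (θ - D.θ₀) (pair x u) + D.θ₀ (pair 0 η) ∈ D.lumpedExcitedSet :=
  Set.add_mem_add ⟨w, mem_closedBall_zero_iff.2 hw, x, hx, u, hu, θ, hθ, rfl⟩
    ⟨η, mem_closedBall_zero_iff.2 hη, rfl⟩

/-- Take `θ = θ₀` and zero excitation. Consequently the tube contains the process noise ball. -/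
lemma closedBall_subset_lumpedExcitedSet (hX : D.X.Nonempty) (hU : D.U.Nonempty)
    (hθ₀ : D.θ₀ ∈ D.Θ₀) (hη : 0 ≤ D.ηmax) {w : E n} (hw : ‖w‖ ≤ D.wmax) :
    w ∈ D.lumpedExcitedSet := by
  obtain ⟨x, hx⟩ := hX
  obtain ⟨u, hu⟩ := hU
  have h := mem_lumpedExcitedSet (η := 0) hx hu hθ₀ hw (by simpa using hη)
  have h0 : pair (0 : E n) (0 : E m) = 0 := rfl
  simpa [h0] using h

/-- The tube absorbs one step of the error dynamics. -/
lemma AK_add_mem_tube {e s : E n} (he : e ∈ D.tube) (hs : s ∈ D.lumpedExcitedSet) :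
    D.AK e + s ∈ D.tube := by
  obtain ⟨f, hf, hsum⟩ := he
  set g : ℕ → E n := fun i => if i = 0 then s else f (i - 1) with hg
  have hg0 : g 0 = s := rfl
  have hg1 : ∀ i, g (i + 1) = f i := fun i => rfl
  refine ⟨g, fun i => ?_, ?_⟩
  · cases i with
    | zero => exact hs
    | succ i => exact hf i
  · have h1 : HasSum (fun i => (D.AK ^ (i + 1)) (g (i + 1))) (D.AK e) := by
      have h2 := D.AK.hasSum hsum
      simpa only [pow_succ', mul_apply_eq_comp, hg1] using h2
    have h3 := (hasSum_nat_add_iff (f := fun i => (D.AK ^ i) (g i)) 1).1 h1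
    simpa [hg0] using h3

lemma zero_mem_tube (hS : (0 : E n) ∈ D.lumpedExcitedSet) : (0 : E n) ∈ D.tube :=
  ⟨fun _ => 0, fun _ => hS, by simp⟩

lemma mem_tube (hS : (0 : E n) ∈ D.lumpedExcitedSet) {s : E n} (hs : s ∈ D.lumpedExcitedSet) :
    s ∈ D.tube := by
  simpa using AK_add_mem_tube (zero_mem_tube hS) hs

/-- The first nominal state and input of a feasible plan satisfy the tightened constraints. -/
lemma Feasible.tight {I : Set (E n)} {x xbar : E n} {v : ℕ → E m} (h : D.Feasible I x xbar v)
    (hW : 1 ≤ D.W) : xbar ∈ D.tightX ∧ D.K xbar + v 0 ∈ D.tightU := h.2.1 0 hW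

lemma Feasible.mem_X {I : Set (E n)} (hI : I ⊆ D.tube) {x xbar : E n} {v : ℕ → E m}
    (h : D.Feasible I x xbar v) (hW : 1 ≤ D.W) : x ∈ D.X := by
  simpa using (h.tight hW).1 _ (hI h.1)

/-- The actual input is the nominal one, `K xbar + v 0`, plus `K (x - xbar) + η`, which the
tightening of `U` allows for. -/
lemma Feasible.mem_U {I : Set (E n)} (hI : I ⊆ D.tube) {x xbar : E n} {v : ℕ → E m}
    (h : D.Feasible I x xbar v) (hW : 1 ≤ D.W) {η : E m} (hη : ‖η‖ ≤ D.ηmax) :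
    D.K x + v 0 + η ∈ D.U := by
  have h1 := (h.tight hW).2 _ (Set.add_mem_add (Set.mem_image_of_mem D.K (hI h.1))
    (mem_closedBall_zero_iff.2 hη))
  rw [map_sub] at h1
  convert h1 using 1
  abel

/-- Recursive feasibility, when the initial nominal state is free in the tube. -/
lemma Feasible.exists_next (hterm : D.TerminalInvariant) (hW : 1 ≤ D.W) {θ : Param n m}
    (hθ : θ ∈ D.Θ₀) {x xbar : E n} {v : ℕ → E m} (h : D.Feasible D.tube x xbar v)
    {w : E n} {η : E m} (hw : ‖w‖ ≤ D.wmax) (hη : ‖η‖ ≤ D.ηmax) :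
    ∃ xbar' v', D.Feasible D.tube (θ (pair x (D.K x + v 0 + η)) + w) xbar' v' := by
  obtain ⟨u, hu, hu'⟩ := hterm.2 _ h.2.2
  -- The old plan is shifted by one step, and the terminal input `u` is appended in the form of a
  -- correction to `K`.
  set v' : ℕ → E m := fun k => if k + 1 < D.W then v (k + 1) else u - D.K (D.predX xbar v D.W)
    with hv'
  have hpred : ∀ k, k + 1 ≤ D.W → D.predX (D.predX xbar v 1) v' k = D.predX xbar v (k + 1) := by
    intro k
    induction k with
    | zero => intro _; rfl
    | succ k ih =>
      intro hk
      have h1 : v' k = v (k + 1) := by rw [hv']; exact if_pos hk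
      rw [predX, ih (by omega), h1, predX.eq_2 D xbar v (k + 1)]
  have hlast : D.predU (D.predX xbar v 1) v' (D.W - 1) = u := by
    rw [predU, hpred _ (by omega), Nat.sub_add_cancel hW]
    have h1 : v' (D.W - 1) = u - D.K (D.predX xbar v D.W) := by
      rw [hv']; exact if_neg (by omega)
    rw [h1]; abel
  refine ⟨D.predX xbar v 1, v', ?_, fun k hk => ?_, ?_⟩
  -- The error moves to `AK (x - xbar) + s`, where `s` collects `w`, the model mismatch `(θ - θ₀) z`
  -- and `B₀ η`.
  · have hs := mem_lumpedExcitedSet (h.mem_X subset_rfl hW) (h.mem_U subset_rfl hW hη) hθ hw hη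
    convert AK_add_mem_tube h.1 hs using 1
    have e1 : pair (x - xbar) (D.K (x - xbar)) + pair 0 η + pair xbar (D.K xbar + v 0) =
        pair x (D.K x + v 0 + η) := by
      rw [pair_add_pair, pair_add_pair, map_sub]
      congr 1 <;> abel
    rw [AK_apply, sub_apply, ← e1]
    simp only [map_add, predX]
    abel
  · by_cases hk' : k + 1 < D.W
    · rw [predU, hpred k hk]
      have h1 : v' k = v (k + 1) := by rw [hv']; exact if_pos hk'
      rw [h1]
      exact h.2.1 (k + 1) hk'
    · obtain rfl : k = D.W - 1 := by omega
      refine ⟨?_, by rw [hlast]; exact hu⟩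
      rw [hpred _ hk, Nat.sub_add_cancel hW]
      exact hterm.1 h.2.2
  · have h1 := hpred (D.W - 1) (by omega)
    rw [← Nat.sub_add_cancel hW, predX]
    rw [predU] at hlast
    rw [hlast, h1, Nat.sub_add_cancel hW]
    exact hu'

end Design

/-! ### Constraint satisfaction along the closed loop -/

section closedLoop

variable {Ω : Type*} {n m : ℕ} {D : Design n m} {θ : Param n m} {w : ℕ → Ω → E n}
  {η : ℕ → Ω → E m} {σw ση : ℝ}
  {π : E n → E m} {x₀ : E n} {T : ℕ}

/-- Changing the policy away from the visited states does not change the trajectory. -/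
lemma state_congr {π' : E n → E m} {ω : Ω} :
    ∀ {t : ℕ}, (∀ j < t, π' (state θ π x₀ w η j ω) = π (state θ π x₀ w η j ω)) →
      state θ π' x₀ w η t ω = state θ π x₀ w η t ω
  | 0, _ => rfl
  | t + 1, h => by
    rw [state, state, state_congr fun j hj => h j (by omega), h t (by omega)]

variable [MeasurableSpace Ω] {μ : Measure Ω}

/-- Along the closed loop, the measured state is feasible and the input is an RMPC input, for one
choice of the initial constraint. -/
lemma ae_isInput (hW : 1 ≤ D.W) (hθ : θ ∈ D.Θ₀) (hw : IsNoise μ w D.wmax σw)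
    (hη : IsNoise μ η D.ηmax ση) (h0 : (0 : E n) ∈ D.tube)
    (hgen : (∀ᵐ ω ∂μ, ∀ t ≤ T, D.IsInput {0} (state θ π x₀ w η t ω) (π (state θ π x₀ w η t ω))) ∨
      (D.TerminalInvariant ∧ (∃ xbar v, D.Feasible D.tube x₀ xbar v) ∧
        ∀ x, (∃ xbar v, D.Feasible D.tube x xbar v) → D.IsInput D.tube x (π x))) :
    ∃ I ⊆ D.tube, ∀ᵐ ω ∂μ, ∀ t ≤ T,
      D.IsInput I (state θ π x₀ w η t ω) (π (state θ π x₀ w η t ω)) := by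
  rcases hgen with h | ⟨hterm, hx₀, h⟩
  · exact ⟨{0}, by simpa using h0, h⟩
  · refine ⟨D.tube, subset_rfl, ?_⟩
    filter_upwards [ae_all_iff.2 hw.bdd, ae_all_iff.2 hη.bdd] with ω h1 h2 t _
    refine h _ ?_
    induction t with
    | zero => exact hx₀
    | succ t ih =>
      obtain ⟨xbar, v, hf, -, hu⟩ := h _ (ih (by omega))
      rw [state, hu]
      exact hf.exists_next hterm hW hθ (h1 t) (h2 t)

variable [IsProbabilityMeasure μ]

/-- Along the closed loop, the constraints hold with room for the excitation, and they leave room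
for the noise. -/
lemma ae_mem_constraints (hX : D.X.Nonempty) (hU : D.U.Nonempty) (hW : 1 ≤ D.W)
    (hθ₀ : D.θ₀ ∈ D.Θ₀) (hθ : θ ∈ D.Θ₀) (hw : IsNoise μ w D.wmax σw)
    (hη : IsNoise μ η D.ηmax ση)
    (hgen : (∀ᵐ ω ∂μ, ∀ t ≤ T, D.IsInput {0} (state θ π x₀ w η t ω) (π (state θ π x₀ w η t ω))) ∨
      (D.TerminalInvariant ∧ (∃ xbar v, D.Feasible D.tube x₀ xbar v) ∧
        ∀ x, (∃ xbar v, D.Feasible D.tube x xbar v) → D.IsInput D.tube x (π x))) :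
    (∃ x u, ∀ e v, ‖e‖ ≤ D.wmax → ‖v‖ ≤ D.ηmax → x + e ∈ D.X ∧ u + v ∈ D.U) ∧
    ∀ᵐ ω ∂μ, ∀ t ≤ T, state θ π x₀ w η t ω ∈ D.X ∧
      ∀ v, ‖v‖ ≤ D.ηmax → π (state θ π x₀ w η t ω) + v ∈ D.U := by
  have hball : ∀ e : E n, ‖e‖ ≤ D.wmax → e ∈ D.lumpedExcitedSet := fun e he =>
    Design.closedBall_subset_lumpedExcitedSet hX hU hθ₀ hη.nonneg he
  have h0 := hball 0 (by simpa using hw.nonneg)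
  obtain ⟨I, hI, h⟩ := ae_isInput hW hθ hw hη (Design.zero_mem_tube h0) hgen
  refine ⟨?_, ?_⟩
  -- One outcome suffices: its nominal state at time `0` has room for the tube, hence for the noise
  -- ball.
  · obtain ⟨ω, hω⟩ := h.exists
    obtain ⟨xbar, v, hf, -, hu⟩ := hω 0 (Nat.zero_le _)
    refine ⟨xbar, _, fun e u he hv => ⟨(hf.tight hW).1 e (Design.mem_tube h0 (hball e he)),
      hf.mem_U hI hW hv⟩⟩
  · filter_upwards [h] with ω hω t ht
    obtain ⟨xbar, v, hf, -, hu⟩ := hω t ht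
    exact ⟨hf.mem_X hI hW, fun η' hη' => hu ▸ hf.mem_U hI hW hη'⟩

end closedLoop

/-! ### Normal equations and projection -/

section leastSquares

variable {n m : ℕ}

/-- The `i`-th row of a parameter. -/
noncomputable def row (θ : Param n m) (i : Fin n) : Z n m :=
  ContinuousLinearMap.adjoint θ (EuclideanSpace.single i 1)

lemma inner_row (θ : Param n m) (i : Fin n) (z : Z n m) : inner ℝ (row θ i) z = θ z i := by
  rw [row, ContinuousLinearMap.adjoint_inner_left, EuclideanSpace.inner_single_left]
  simp

lemma norm_le_of_norm_row_le {θ : Param n m} {ε : ℝ} (hε : 0 ≤ ε) (h : ∀ i, ‖row θ i‖ ≤ ε) :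
    ‖θ‖ ≤ √n * ε := by
  refine θ.opNorm_le_bound (by positivity) fun z => ?_
  refine abs_le_of_sq_le_sq' ?_ (by positivity) |>.2
  rw [EuclideanSpace.real_norm_sq_eq]
  calc ∑ i, θ z i ^ 2 ≤ ∑ _i : Fin n, (ε * ‖z‖) ^ 2 := Finset.sum_le_sum fun i _ => by
        rw [← inner_row, ← sq_abs]
        have h1 := abs_real_inner_le_norm (row θ i) z
        have h2 := h i
        gcongr
        exact h1.trans (by gcongr)
    _ = _ := by
        rw [mul_pow, mul_pow, mul_pow, Real.sq_sqrt (Nat.cast_nonneg n)]; simp; ring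

lemma eq_zero_of_forall_quadratic {A B : ℝ} (hB : 0 ≤ B)
    (h : ∀ τ : ℝ, 0 ≤ -2 * τ * A + τ ^ 2 * B) : A = 0 := by
  -- The minimizer would be `A / B`; the shift by `1` also covers `B = 0`.
  have h1 := h (A / (B + 1))
  have h2 : -2 * (A / (B + 1)) * A + (A / (B + 1)) ^ 2 * B = -(A ^ 2 * (B + 2)) / (B + 1) ^ 2 := by
    field_simp; ring
  rw [h2, le_div_iff₀ (by positivity), zero_mul] at h1
  have h3 : 0 ≤ A ^ 2 * B := by positivity
  exact pow_eq_zero_iff two_ne_zero |>.1 (by nlinarith [sq_nonneg A])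

/-- The normal equations, row by row. -/
lemma IsLeastSquares.normalEq {T : ℕ} {x : ℕ → E n} {z : ℕ → Z n m} {w : ℕ → E n}
    {θ θhat : Param n m} (h : IsLeastSquares T x z θhat) (hx : ∀ s, x (s + 1) = θ (z s) + w s)
    (i : Fin n) (a : Z n m) :
    ∑ s ∈ Finset.range T, inner ℝ a (z s) * (w s i - inner ℝ (row (θhat - θ) i) (z s)) = 0 := by
  refine eq_zero_of_forall_quadratic (B := ∑ s ∈ Finset.range T, inner ℝ a (z s) ^ 2)
    (by positivity) fun τ => ?_
  -- A rank-one variation along `a` that changes row `i` alone isolates the equation of that row.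
  have h1 := h (θhat + τ • (innerSL ℝ a).smulRight (EuclideanSpace.single i (1 : ℝ)))
  have h2 : ∀ s, ‖x (s + 1) - (θhat + τ • (innerSL ℝ a).smulRight
      (EuclideanSpace.single i (1 : ℝ))) (z s)‖ ^ 2 = ‖x (s + 1) - θhat (z s)‖ ^ 2 +
      (-2 * τ * (inner ℝ a (z s) * (w s i - inner ℝ (row (θhat - θ) i) (z s))) +
        τ ^ 2 * inner ℝ a (z s) ^ 2) := by
    intro s
    have e1 : x (s + 1) - (θhat + τ • (innerSL ℝ a).smulRight
        (EuclideanSpace.single i (1 : ℝ))) (z s) = (x (s + 1) - θhat (z s)) -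
        (τ * inner ℝ a (z s)) • EuclideanSpace.single i (1 : ℝ) := by
      simp [smul_smul, sub_sub]
    rw [e1, norm_sub_sq_real, real_inner_smul_right, EuclideanSpace.inner_single_right, norm_smul,
      inner_row, hx]
    simp [mul_pow]
    ring
  rw [Finset.sum_congr rfl fun s _ => h2 s, Finset.sum_add_distrib, Finset.sum_add_distrib,
    ← Finset.mul_sum, ← Finset.mul_sum] at h1
  linarith

end leastSquares

/-- Only the triangle inequality is available, since `S` need not be convex; hence the factor `2`.
-/
lemma IsProjection.norm_sub_le_two_mul {F : Type*} [NormedAddCommGroup F] {S : Set F} {a p q : F}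
    (h : IsProjection S a p) (hq : q ∈ S) : ‖p - q‖ ≤ 2 * ‖a - q‖ := by
  have h1 : ‖a - p‖ ≤ ‖a - q‖ := (sq_le_sq₀ (norm_nonneg _) (norm_nonneg _)).1 (h.2 q hq)
  have h2 : p - q = (a - q) - (a - p) := by abel
  rw [h2]
  exact (norm_sub_le (a - q) (a - p)).trans (by linarith)

/-! ### Numerical inequalities for the sample size and the deviation -/

section numerics

lemma exp_eight_bound : (2560 : ℝ) ≤ Real.exp 8 := by
  have h := Real.exp_one_gt_d9
  have h1 : (2.7182 : ℝ) ≤ Real.exp 1 := by linarith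
  calc (2560 : ℝ) ≤ 2.7182 ^ 8 := by norm_num
    _ ≤ Real.exp 1 ^ 8 := by gcongr
    _ = Real.exp 8 := by rw [← Real.exp_nat_mul]; norm_num

variable {d T : ℕ} {b s X L δ : ℝ}

/-- The sample size suffices for the lower bound on the Gram form. -/
lemma two_pow_mul_exp_le (hd : 1 ≤ d) (hb : 0 < b) (hs : 0 < s) (hX : 0 < X) (hXL : 1 ≤ X ^ 2)
    (hL : 1 ≤ L) (hδ : 0 < δ) (hLδ : 1 / δ ≤ Real.exp L) (hLk : X * b / s ≤ 64 * Real.exp (2 * L))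
    (hT : 2200 * (d * X ^ 2 * L) ≤ (T + 1 : ℕ)) :
    2 ^ d * Real.exp (-(1 / (25 * X ^ 2) * T)) ≤ δ * ((s / (20 * X * b)) ^ d *
      Real.exp (-(9 / 2 * (s ^ 2 * (T + 1 : ℕ) / (625 * X ^ 2)) +
        2 * (s / (20 * X * b)) ^ 2 * (T + 1 : ℕ) * b ^ 2) / s ^ 2)) := by
  -- The volume ratio `2 / r` per dimension is paid for by `exp (10 L)`.
  have h1 : 2 ≤ s / (20 * X * b) * Real.exp (10 * L) := by
    have e1 : Real.exp (10 * L) = Real.exp (2 * L) * Real.exp (8 * L) := by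
      rw [← Real.exp_add]; ring_nf
    have e2 : (2560 : ℝ) ≤ Real.exp (8 * L) :=
      exp_eight_bound.trans (Real.exp_le_exp.2 (by linarith))
    have e3 := (div_le_iff₀ hs).1 hLk
    rw [div_mul_eq_mul_div, le_div_iff₀ (by positivity), e1]
    have e4 := mul_le_mul_of_nonneg_left e2 (by positivity : 0 ≤ Real.exp (2 * L) * s)
    nlinarith [Real.exp_pos (2 * L)]
  have h2 : 1 ≤ δ * Real.exp L := by rwa [div_le_iff₀' hδ] at hLδ
  have hd' : (1 : ℝ) ≤ d := by exact_mod_cast hd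
  have hexp : 10 * L * d + L + -(1 / (25 * X ^ 2) * T) ≤
      -(9 / 2 * (s ^ 2 * (T + 1 : ℕ) / (625 * X ^ 2)) +
        2 * (s / (20 * X * b)) ^ 2 * (T + 1 : ℕ) * b ^ 2) / s ^ 2 := by
    -- `61/5000 = (9/2)/625 + 2/400` is the loss per sample, against the gain `1/25`, both in units
    -- of `1 / X²`. The difference absorbs `10 d L + L` once `T` exceeds `2200 d X² L`.
    have e1 : -(9 / 2 * (s ^ 2 * (T + 1 : ℕ) / (625 * X ^ 2)) +
        2 * (s / (20 * X * b)) ^ 2 * (T + 1 : ℕ) * b ^ 2) / s ^ 2 =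
        -(61 / 5000 * (T + 1 : ℕ)) / X ^ 2 := by field_simp; norm_num
    have e2 : 10 * L * d + L + -(1 / (25 * X ^ 2) * T) =
        ((10 * L * d + L) * X ^ 2 - T / 25) / X ^ 2 := by field_simp; ring
    rw [e1, e2]
    gcongr
    push_cast at hT ⊢
    have e3 : L * X ^ 2 ≤ d * X ^ 2 * L := by
      have : 0 < X ^ 2 * L := by positivity
      nlinarith
    have e4 : 1 ≤ L * X ^ 2 := by nlinarith
    nlinarith
  calc 2 ^ d * Real.exp (-(1 / (25 * X ^ 2) * T))
      ≤ (s / (20 * X * b) * Real.exp (10 * L)) ^ d * Real.exp (-(1 / (25 * X ^ 2) * T)) := by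
        gcongr
    _ ≤ (s / (20 * X * b) * Real.exp (10 * L)) ^ d * Real.exp (-(1 / (25 * X ^ 2) * T)) *
        (δ * Real.exp L) := le_mul_of_one_le_right (by positivity) h2
    _ = δ * ((s / (20 * X * b)) ^ d *
        Real.exp (10 * L * d + L + -(1 / (25 * X ^ 2) * T))) := by
        rw [mul_pow, ← Real.exp_nat_mul, Real.exp_add, Real.exp_add]
        ring_nf
    _ ≤ _ := by gcongr

/-- The deviation level suffices for the self-normalized bound. -/
lemma two_mul_pow_le {k y r N : ℝ} (hd : 1 ≤ d) (hL : 1 ≤ L) (hδ : 0 < δ) (hN : 0 < N)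
    (hLN : N / δ ≤ Real.exp L) (hk : 1 ≤ k) (hLk : k ≤ Real.exp (10 * L)) (hr : 0 < r)
    (hX : X ≤ Real.exp L) (hX0 : 0 ≤ X) (hdX : (d : ℝ) ≤ 2 * X ^ 2) (hy : 0 ≤ y)
    (hy2 : y ^ 2 = 64 * (d * L)) :
    2 * (r * (1 + y * k)) ^ d ≤ δ / N * (r ^ d * Real.exp (y ^ 2 / 2 - 1 / 2)) := by
  have hd' : (1 : ℝ) ≤ d := by exact_mod_cast hd
  have hdL : L ≤ d * L := by nlinarith
  have h1 : 1 + y ≤ Real.exp (5 * L) := by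
    -- The dimension inside `y` is controlled by `d ≤ 2X²` and `X ≤ exp L`, so it adds no new
    -- logarithm.
    have e1 : y ^ 2 ≤ 128 * Real.exp (3 * L) := by
      have e2 : (d : ℝ) ≤ 2 * Real.exp L ^ 2 := hdX.trans (by gcongr)
      have e3 : L ≤ Real.exp L := by linarith [Real.add_one_le_exp L]
      have e4 : Real.exp (3 * L) = Real.exp L ^ 2 * Real.exp L := by
        rw [← pow_succ, ← Real.exp_nat_mul]; norm_num
      rw [hy2, e4]
      have : (d : ℝ) * L ≤ 2 * Real.exp L ^ 2 * Real.exp L := by gcongr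
      linarith
    have e5 : (2.7182 : ℝ) ^ 7 ≤ Real.exp (7 * L) := by
      have h := Real.exp_one_gt_d9
      calc (2.7182 : ℝ) ^ 7 ≤ Real.exp 1 ^ 7 := by gcongr; linarith
        _ = Real.exp 7 := by rw [← Real.exp_nat_mul]; norm_num
        _ ≤ _ := Real.exp_le_exp.2 (by linarith)
    have e6 : Real.exp (5 * L) ^ 2 = Real.exp (7 * L) * Real.exp (3 * L) := by
      rw [← Real.exp_nat_mul, ← Real.exp_add]; ring_nf
    have e7 : 1 ≤ y := by nlinarith
    refine abs_le_of_sq_le_sq' ?_ (Real.exp_pos _).le |>.2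
    rw [e6]
    have e8 : 512 * Real.exp (3 * L) ≤ Real.exp (7 * L) * Real.exp (3 * L) := by
      gcongr; exact le_trans (by norm_num) e5
    nlinarith
  have h2 : 1 + y * k ≤ Real.exp (15 * L) := by
    have e1 : Real.exp (15 * L) = Real.exp (5 * L) * Real.exp (10 * L) := by
      rw [← Real.exp_add]; ring_nf
    rw [e1]
    calc 1 + y * k ≤ (1 + y) * k := by linarith
      _ ≤ _ := by gcongr
  have h3 : 1 ≤ δ / N * Real.exp L := by
    rw [div_le_iff₀ hδ] at hLN
    rw [div_mul_eq_mul_div, le_div_iff₀ hN]; linarith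
  have h4 : (2 : ℝ) ≤ Real.exp L := by linarith [Real.add_one_le_exp L]
  -- The exponent needed is `15 d L + 2 L`, while `y² / 2 = 32 d L`.
  have h5 : Real.exp L * (r ^ d * Real.exp (15 * L) ^ d) * Real.exp L ≤
      r ^ d * Real.exp (y ^ 2 / 2 - 1 / 2) := by
    rw [← Real.exp_nat_mul]
    calc _ = r ^ d * Real.exp (L + d * (15 * L) + L) := by rw [Real.exp_add, Real.exp_add]; ring
      _ ≤ _ := by
        gcongr
        rw [hy2]; nlinarith
  calc 2 * (r * (1 + y * k)) ^ d ≤ Real.exp L * (r * Real.exp (15 * L)) ^ d := by gcongr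
    _ ≤ Real.exp L * (r * Real.exp (15 * L)) ^ d * (δ / N * Real.exp L) :=
        le_mul_of_one_le_right (by positivity) h3
    _ = δ / N * (Real.exp L * (r ^ d * Real.exp (15 * L) ^ d) * Real.exp L) := by
        rw [mul_pow]; ring
    _ ≤ _ := by gcongr

end numerics

/-! ### Estimation error for a bounded policy -/

section estimation

variable {Ω : Type*} [MeasurableSpace Ω] {μ : Measure Ω} [IsProbabilityMeasure μ] {n m : ℕ}
  {w : ℕ → Ω → E n} {η : ℕ → Ω → E m} {ρw ρη σw ση : ℝ}

lemma finrank_Z (n m : ℕ) : Module.finrank ℝ (Z n m) = n + m := by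
  rw [(WithLp.linearEquiv 2 ℝ (E n × E m)).finrank_eq]; simp

lemma IsNoise.le_radius (h : IsNoise μ w ρw σw) (hn : 1 ≤ n) : σw ≤ ρw := by
  have h1 : (1 : ℝ) ≤ n := by exact_mod_cast hn
  refine abs_le_of_sq_le_sq' ?_ h.nonneg |>.2
  nlinarith [h.card_mul_sq_le, sq_nonneg σw]

/-- The mixing radius is `r` times a quantity free of `T`, so the volume ratio in the
self-normalized bound does not grow with the sample size. -/
lemma deviation_add_radius {ρ b s X T y : ℝ} (hρ : 0 < ρ) (hb : 0 < b) (hs : 0 < s) (hT : 0 < T) :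
    ρ * y * (25 * X) / (s * √T) / ρ ^ 2 + 1 / (ρ * b * √T) =
      1 / (ρ * b * √T) * (1 + y * (25 * (X * b / s))) := by
  have := Real.sqrt_pos.2 hT
  field_simp
  ring

lemma sq_deviation_mul {ρ s X T y : ℝ} (hρ : 0 < ρ) (hs : 0 < s) (hX : 0 < X) (hT : 0 < T) :
    (ρ * y * (25 * X) / (s * √T)) ^ 2 * (s ^ 2 * T / (625 * X ^ 2)) / (2 * ρ ^ 2) = y ^ 2 / 2 := by
  rw [div_pow, mul_pow s, Real.sq_sqrt hT.le]
  field_simp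
  norm_num

set_option maxHeartbeats 1000000 in
/-- Least-squares error bound for a bounded policy, in terms of the normal equations. -/
lemma measure_normalEq_error_le (hn : 1 ≤ n) (hm : 1 ≤ m) (hw : IsNoise μ w ρw σw)
    (hη : IsNoise μ η ρη ση) (hwη : IndepFun (fun ω t => w t ω) (fun ω t => η t ω) μ)
    (θ : Param n m) {π : E n → E m} (hπ : Measurable π) (x₀ : E n) {b X L δ s ε : ℝ}
    (hπb : ∀ x, ‖π x‖ ≤ b) (hρw : ρw ≤ b) (hρη : ρη ≤ b) (hX : 1 ≤ X) (hwX : ρw / σw ≤ X)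
    (hηX : ρη / ση ≤ X) (hL : 1 ≤ L) (hδ : 0 < δ) (hLδ : 1 / δ ≤ Real.exp L)
    (hLn : n / δ ≤ Real.exp L) (hLX : X ≤ Real.exp L)
    (hLb : b ^ 2 * X / (σw * ση) ≤ Real.exp (2 * L))
    (hdX : ((n + m : ℕ) : ℝ) ≤ 2 * X ^ 2) {T : ℕ} (hT : 2200 * ((n + m : ℕ) * X ^ 2 * L) ≤ T)
    (hs : s = σw * ση / (64 * b))
    (hε : ε = ρw * (8 * √((n + m : ℕ) * L)) * (25 * X) / (s * √T)) :
    μ {ω | (∀ t < T, ‖stacked θ π x₀ w η t ω‖ ≤ b) ∧ ∃ Δ : Param n m,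
      (∀ i a, ∑ t ∈ Finset.range T, inner ℝ a (stacked θ π x₀ w η t ω) *
        (w t ω i - inner ℝ (row Δ i) (stacked θ π x₀ w η t ω)) = 0) ∧ √n * ε < ‖Δ‖} ≤
      ENNReal.ofReal (2 * δ) := by
  have hσw0 := hw.pos
  have hση0 := hη.pos
  have hσρw := hw.le_radius hn
  have hσρη := hη.le_radius hm
  have hρw0 : 0 < ρw := hσw0.trans_le hσρw
  have hρη0 : 0 < ρη := hση0.trans_le hσρη
  have hb : 0 < b := hρw0.trans_le hρw
  have hs0 : 0 < s := by rw [hs]; positivity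
  have hsb : s ≤ b := by
    rw [hs, div_le_iff₀ (by positivity)]
    have : σw * ση ≤ b * b := by gcongr <;> linarith
    nlinarith
  have hn' : (0 : ℝ) < n := by exact_mod_cast hn
  set d := n + m with hd
  have hd1 : 1 ≤ d := by omega
  have hd1' : (1 : ℝ) ≤ d := by exact_mod_cast hd1
  have hT0 : (0 : ℝ) < T := lt_of_lt_of_le (by positivity) hT
  have hLk : X * b / s ≤ 64 * Real.exp (2 * L) := by
    have : X * b / s = 64 * (b ^ 2 * X / (σw * ση)) := by rw [hs]; field_simp
    rw [this]; gcongr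
  set z := stacked θ π x₀ w η with hz
  have hzm : ∀ t, Measurable (z t) := fun t =>
    measurable_stacked hπ x₀ t (fun j _ => hw.meas j) fun j _ => hη.meas j
  set l := s ^ 2 * T / (625 * X ^ 2) with hl
  have hl0 : 0 < l := by positivity
  set y := 8 * √(d * L) with hy
  have hy0 : 0 < y := by positivity
  have hy2 : y ^ 2 = 64 * (d * L) := by
    rw [hy, mul_pow, Real.sq_sqrt (by positivity)]; norm_num
  have hε0 : 0 < ε := by rw [hε]; positivity
  have hsqT : √(T : ℝ) ^ 2 = T := Real.sq_sqrt hT0.le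
  have hA : μ {ω | (∀ t < T, ‖z t ω‖ ≤ b) ∧ ∃ c : Z n m, ‖c‖ = 1 ∧
      ∑ t ∈ Finset.range T, inner ℝ c (z t ω) ^ 2 < l} ≤ ENNReal.ofReal δ := by
    obtain ⟨T', rfl⟩ : ∃ T', T = T' + 1 :=
      Nat.exists_eq_succ_of_ne_zero (by rintro rfl; simp at hT0)
    have hp : ∀ {σ ρ : ℝ}, 0 < σ → σ ≤ ρ → ρ / σ ≤ X →
        1 / (25 * X ^ 2) ≤ σ ^ 2 / (24 * ρ ^ 2) := by
      intro σ ρ h1 h2 h3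
      rw [div_le_iff₀ h1] at h3
      have h4 : 0 < ρ := h1.trans_le h2
      rw [div_le_div_iff₀ (by positivity) (by positivity)]
      have : ρ ^ 2 ≤ (X * σ) ^ 2 := by gcongr
      nlinarith [sq_nonneg (X * σ)]
    refine measure_exists_sum_inner_sq_lt_le (r := s / (20 * X * b)) hzm hs0 (by positivity) ?_ hδ
      (fun c hc => lintegral_exp_neg_gram_le hw hη hwη θ hπ x₀ hπb hρη (hσρw.trans hρw)
        (hσρη.trans hρη) hs (hp hσw0 hσρw hwX) (hp hση0 hσρη hηX) hc T') ?_
    · rw [div_le_iff₀ (by positivity)]; nlinarith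
    · rw [finrank_Z]
      exact two_pow_mul_exp_le hd1 hb hs0 (by linarith) (by nlinarith) hL hδ hLδ hLk hT
  have hB : ∀ i : Fin n, μ {ω | (∀ t < T, ‖z t ω‖ ≤ b) ∧ ∃ Δ : Z n m, ε < ‖Δ‖ ∧
      (∀ a : Z n m, ∑ t ∈ Finset.range T, inner ℝ a (z t ω) *
        (w t ω i - inner ℝ Δ (z t ω)) = 0) ∧
      l * ‖Δ‖ ^ 2 ≤ ∑ t ∈ Finset.range T, inner ℝ Δ (z t ω) ^ 2} ≤ ENNReal.ofReal (δ / n) := by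
    intro i
    -- This `r` makes `M² T b² r² = 1`, the largest value for which the quadratic error on the half
    -- ball costs at most `1/2` in the exponent.
    refine measure_exists_normalEq_le (M := ρw) (r := 1 / (ρw * b * √T)) hzm
      (ξ := fun t ω => w t ω i)
      (fun t => (EuclideanSpace.proj i : E n →L[ℝ] ℝ).continuous.measurable.comp (hw.meas t))
      hρw0 (by positivity) (by positivity) hε0 hl0 ?_
      (fun a => lintegral_exp_cross_le hw hη hwη θ hπ x₀ i a T) ?_
    · rw [div_pow, mul_pow, mul_pow, hsqT]
      field_simp
      exact le_rfl
    · rw [finrank_Z, ← hd]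
      have e1 : ε / ρw ^ 2 + 1 / (ρw * b * √T) =
          1 / (ρw * b * √T) * (1 + y * (25 * (X * b / s))) := by
        rw [hε]; exact deviation_add_radius hρw0 hb hs0 hT0
      have e2 : ε ^ 2 * l / (2 * ρw ^ 2) = y ^ 2 / 2 := by
        rw [hε]; exact sq_deviation_mul hρw0 hs0 (by linarith) hT0
      rw [e1, e2]
      have hX0 : 0 ≤ X := by linarith
      have hr0 : 0 < 1 / (ρw * b * √T) := by positivity
      refine two_mul_pow_le (X := X) (L := L) hd1 hL hδ hn' hLn ?_ ?_ hr0 hLX hX0 hdX hy0.le hy2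
      · have : 1 ≤ X * b / s := by rw [le_div_iff₀ hs0]; nlinarith
        linarith
      · have e3 : Real.exp (10 * L) = Real.exp (8 * L) * Real.exp (2 * L) := by
          rw [← Real.exp_add]; ring_nf
        have e4 : (2560 : ℝ) ≤ Real.exp (8 * L) :=
          exp_eight_bound.trans (Real.exp_le_exp.2 (by linarith))
        rw [e3]
        have e5 := mul_le_mul_of_nonneg_right e4 (Real.exp_pos (2 * L)).le
        have e6 := Real.exp_pos (2 * L)
        linarith
  have hunion : ∀ (A : Set Ω) (B : Fin n → Set Ω), μ A ≤ ENNReal.ofReal δ →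
      (∀ i, μ (B i) ≤ ENNReal.ofReal (δ / n)) → μ (A ∪ ⋃ i, B i) ≤ ENNReal.ofReal (2 * δ) := by
    intro A B h1 h2
    refine (measure_union_le _ _).trans ((add_le_add h1 ((measure_iUnion_fintype_le _ _).trans
      (Finset.sum_le_sum fun i _ => h2 i))).trans ?_)
    rw [Finset.sum_const, Finset.card_univ, Fintype.card_fin, nsmul_eq_mul,
      ← ENNReal.ofReal_natCast, ← ENNReal.ofReal_mul hn'.le, ← ENNReal.ofReal_add hδ.le
      (by positivity)]
    refine ENNReal.ofReal_le_ofReal (le_of_eq ?_)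
    field_simp; norm_num
  refine (measure_mono ?_).trans (hunion _ _ hA hB)
  rintro ω ⟨hzb, Δ, hΔ, hlt⟩
  by_contra hcon
  rw [Set.mem_union, not_or] at hcon
  obtain ⟨h1, h2⟩ := hcon
  refine hlt.not_ge (norm_le_of_norm_row_le hε0.le fun i => ?_)
  by_contra hi
  push Not at hi
  refine h2 (Set.mem_iUnion.2 ⟨i, hzb, row Δ i, hi, hΔ i, ?_⟩)
  have h0 : 0 < ‖row Δ i‖ := hε0.trans hi
  by_contra h3
  push Not at h3
  -- A large row that escapes the self-normalized event has a small Gram form, and its direction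
  -- violates the lower bound.
  refine h1 ⟨hzb, ‖row Δ i‖⁻¹ • row Δ i, by rw [norm_smul, norm_inv, norm_norm]; field_simp, ?_⟩
  simp only [real_inner_smul_left, mul_pow, ← Finset.mul_sum]
  rw [inv_pow, inv_mul_lt_iff₀ (by positivity)]
  linarith

end estimation

/-! ### Comparison with the two polynomial factors -/

section constants

variable {b δ wb ηb σw ση : ℝ}

/-- The logarithmic factor dominates all the logarithms that occur in the proof. -/
lemma le_div_mul_poly₁ (hσw : 0 < σw) (hση : 0 < ση) (hwb : 1 ≤ wb) (hηb : 1 ≤ ηb) (hδ : 0 < δ)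
    (hδ' : δ < 1 / 3) (hb : wb * σw ≤ b) :
    wb ^ 2 * max wb ηb / δ ≤ b / δ * poly₁ wb ηb σw ση ∧
    b ^ 2 * max wb ηb / (σw * ση) ≤ (b / δ * poly₁ wb ηb σw ση) ^ 2 := by
  set X := max wb ηb with hX
  have hX1 : 1 ≤ X := hwb.trans (le_max_left _ _)
  have hb0 : 0 < b := lt_of_lt_of_le (by positivity) hb
  have h1 : wb / σw * X ≤ poly₁ wb ηb σw ση :=
    mul_le_mul_of_nonneg_right ((le_max_left _ _).trans (le_max_left _ _)) (by linarith)
  have h2 : ηb / ση * X ≤ poly₁ wb ηb σw ση :=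
    mul_le_mul_of_nonneg_right ((le_max_right _ _).trans (le_max_left _ _)) (by linarith)
  constructor
  · calc wb ^ 2 * X / δ = wb * σw / δ * (wb / σw * X) := by field_simp
      _ ≤ _ := by gcongr
  -- This harmless factor completes the left side to a product of two lower bounds for `b / δ *
  -- poly₁`.
  · have h3 : 1 ≤ wb * ηb * X / δ ^ 2 := by
      rw [one_le_div (by positivity)]
      have : 1 ≤ wb * ηb := by nlinarith
      nlinarith
    calc b ^ 2 * X / (σw * ση) ≤ b ^ 2 * X / (σw * ση) * (wb * ηb * X / δ ^ 2) :=
          le_mul_of_one_le_right (by positivity) h3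
      _ = (b / δ * (wb / σw * X)) * (b / δ * (ηb / ση * X)) := by field_simp
      _ ≤ _ := by
        have h4 : 0 ≤ poly₁ wb ηb σw ση := le_trans (by positivity) h1
        rw [sq]; gcongr

lemma sq_mul_max_le_poly₂ (hwb : 1 ≤ wb) (hηb : 1 ≤ ηb) :
    wb ^ 2 * max wb ηb ≤ poly₂ wb ηb σw ση := by
  have h1 : max wb ηb ≤ max (wb ^ 2) (ηb ^ 2) :=
    max_le_max (by nlinarith) (by nlinarith)
  have h2 : wb ≤ max (max (wb * ση) (ηb * σw)) (wb * ηb) :=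
    le_trans (by nlinarith) (le_max_right _ _)
  have h3 : 1 ≤ max wb ηb := hwb.trans (le_max_left _ _)
  calc wb ^ 2 * max wb ηb = wb * max wb ηb * wb := by ring
    _ ≤ wb * max (wb ^ 2) (ηb ^ 2) * max (max (wb * ση) (ηb * σw)) (wb * ηb) := by gcongr

end constants

/-! ### Noise radii against the size of the constraint set -/

section geometry

variable {n m : ℕ}

/-- The points `x ± e` with `‖e‖ = ρ` are `2ρ` apart and both have norm at most `b`; positive
dimension provides such an `e`. -/
lemma radius_le_of_norm_add_le (hn : 1 ≤ n) {x : E n} {ρ b : ℝ} (hρ : 0 ≤ ρ)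
    (h : ∀ e : E n, ‖e‖ ≤ ρ → ‖x + e‖ ≤ b) : ρ ≤ b := by
  set e : E n := EuclideanSpace.single ⟨0, hn⟩ ρ
  have he : ‖e‖ = ρ := by simp [e, abs_of_nonneg hρ]
  have h1 := h e he.le
  have h2 := h (-e) (by rw [norm_neg, he])
  have h3 : (x + e) - (x + -e) = (2 : ℝ) • e := by rw [two_smul]; abel
  have h4 := norm_sub_le (x + e) (x + -e)
  rw [h3, norm_smul, he, Real.norm_ofNat] at h4
  linarith

lemma norm_fst_le_norm_pair (x : E n) (u : E m) : ‖x‖ ≤ ‖pair x u‖ := by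
  rw [norm_pair]
  exact Real.le_sqrt_of_sq_le (by nlinarith [sq_nonneg ‖u‖])

lemma norm_snd_le_norm_pair (x : E n) (u : E m) : ‖u‖ ≤ ‖pair x u‖ := by
  rw [norm_pair]
  exact Real.le_sqrt_of_sq_le (by nlinarith [sq_nonneg ‖x‖])

end geometry

end RMPC

/-! ### Assembly of the main theorem -/

open RMPC

theorem mainTheorem3 :
    ∃ c₁ > (0 : ℝ), ∃ c₂ > (0 : ℝ),
      ∀ {Ω : Type*} [MeasurableSpace Ω] (μ : Measure Ω) [IsProbabilityMeasure μ]
        (n m : ℕ) (_hn : 1 ≤ n) (_hm : 1 ≤ m)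
        (D : RMPC.Design n m) (_hW : 1 ≤ D.W) (_hθ₀ : D.θ₀ ∈ D.Θ₀)
        (θstar : RMPC.Param n m) (_hθstar : θstar ∈ D.Θ₀)
        (bz : ℝ)
        (_hbz : IsLUB {r : ℝ | ∃ x ∈ D.X, ∃ u ∈ D.U, r = √(‖x‖ ^ 2 + ‖u‖ ^ 2)} bz)
        (w : ℕ → Ω → RMPC.E n) (η : ℕ → Ω → RMPC.E m) (σw ση : ℝ)
        (_hw : RMPC.IsNoise μ w D.wmax σw) (_hη : RMPC.IsNoise μ η D.ηmax ση)
        (_hwη : IndepFun (fun ω t => w t ω) (fun ω t => η t ω) μ)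
        (π : RMPC.E n → RMPC.E m) (_hπ : Measurable π) (x₀ : RMPC.E n)
        (T : ℕ)
        (_hgen :
          (∀ᵐ ω ∂μ, ∀ t ≤ T,
            D.IsInput {0} (RMPC.state θstar π x₀ w η t ω)
              (π (RMPC.state θstar π x₀ w η t ω))) ∨
          (D.TerminalInvariant ∧ (∃ xbar v, D.Feasible D.tube x₀ xbar v) ∧
            ∀ x, (∃ xbar v, D.Feasible D.tube x xbar v) → D.IsInput D.tube x (π x)))
        (θhat θtilde : Ω → RMPC.Param n m)
        (_hLS : ∀ᵐ ω ∂μ, RMPC.IsLeastSquares T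
          (fun t => RMPC.state θstar π x₀ w η t ω)
          (fun t => RMPC.stacked θstar π x₀ w η t ω) (θhat ω))
        (_hproj : ∀ᵐ ω ∂μ, RMPC.IsProjection D.Θ₀ (θhat ω) (θtilde ω))
        (δ : ℝ) (_hδ : 0 < δ) (_hδ' : δ < 1 / 3)
        (wb ηb : ℝ) (_hwb : wb = D.wmax / σw) (_hηb : ηb = D.ηmax / ση)
        (_hT : c₁ * (((m : ℝ) + n) * max (wb ^ 4) (ηb ^ 4) *
          Real.log (bz / δ * RMPC.poly₁ wb ηb σw ση)) ≤ T),
        μ {ω | ¬ (‖θtilde ω - θstar‖ ≤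
          c₂ * (bz * √((m : ℝ) + n) / (√(T : ℝ) * ση) * RMPC.poly₂ wb ηb σw ση *
            √(Real.log (bz / δ) + Real.log (RMPC.poly₁ wb ηb σw ση))))}
          ≤ ENNReal.ofReal (3 * δ) := by
  refine ⟨2200, by norm_num, 25600, by norm_num, ?_⟩
  intro Ω _ μ _ n m hn hm D hW hθ₀ θstar hθstar bz hbz w η σw ση hw hη hwη π hπ x₀ T hgen θhat
    θtilde hLS hproj δ hδ hδ' wb ηb hwb hηb hT
  have hσw := hw.pos
  have hση := hη.pos
  obtain ⟨-, x₁, hx₁, u₁, hu₁, -⟩ := hbz.nonempty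
  have hpair : ∀ {x u}, x ∈ D.X → u ∈ D.U → ‖pair x u‖ ≤ bz := fun {x u} hx hu =>
    hbz.1 ⟨x, hx, u, hu, norm_pair x u⟩
  obtain ⟨⟨x₂, u₂, hroom⟩, hcl⟩ :=
    ae_mem_constraints ⟨x₁, hx₁⟩ ⟨u₁, hu₁⟩ hW hθ₀ hθstar hw hη hgen
  have hwmax : D.wmax ≤ bz := radius_le_of_norm_add_le hn hw.nonneg fun e he =>
    (norm_fst_le_norm_pair _ _).trans
      (hpair (hroom e 0 he (by simpa using hη.nonneg)).1 (hroom e 0 he (by simpa using hη.nonneg)).2)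
  have hηmax : D.ηmax ≤ bz := radius_le_of_norm_add_le hm hη.nonneg fun v hv =>
    (norm_snd_le_norm_pair _ _).trans
      (hpair (hroom 0 v (by simpa using hw.nonneg) hv).1 (hroom 0 v (by simpa using hw.nonneg) hv).2)
  have hwb1 : 1 ≤ wb := by rw [hwb, one_le_div hσw]; exact hw.le_radius hn
  have hηb1 : 1 ≤ ηb := by rw [hηb, one_le_div hση]; exact hη.le_radius hm
  have hnw : (n : ℝ) ≤ wb ^ 2 := by
    rw [hwb, div_pow, le_div_iff₀ (by positivity)]; exact hw.card_mul_sq_le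
  have hmη : (m : ℝ) ≤ ηb ^ 2 := by
    rw [hηb, div_pow, le_div_iff₀ (by positivity)]; exact hη.card_mul_sq_le
  have hwσ : wb * σw = D.wmax := by rw [hwb]; field_simp
  have hbz0 : 0 < bz := by
    have : 0 < wb * σw := by positivity
    linarith
  set X := max wb ηb with hX
  have hX1 : 1 ≤ X := hwb1.trans (le_max_left _ _)
  have hwX : wb ≤ X := le_max_left _ _
  have hηX : ηb ≤ X := le_max_right _ _
  set B := bz / δ * poly₁ wb ηb σw ση with hB
  obtain ⟨hB1, hB2⟩ := le_div_mul_poly₁ hσw hση hwb1 hηb1 hδ hδ' (hwσ.trans_le hwmax)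
  rw [← hB, ← hX] at hB1 hB2
  -- The assumption `δ < 1/3` makes the argument of the logarithm at least `3 > e`, so that `L ≥ 1`.
  have hXδ : X * 3 ≤ X / δ := by
    rw [le_div_iff₀ hδ]; nlinarith
  have hwb2 : 1 ≤ wb ^ 2 := by nlinarith
  have hBX : X / δ ≤ B := le_trans (by gcongr; nlinarith) hB1
  have hB0 : 0 < B := by linarith
  have hpoly : 0 < poly₁ wb ηb σw ση := by
    by_contra h
    push Not at h
    exact hB0.not_ge (mul_nonpos_of_nonneg_of_nonpos (by positivity) h)
  set L := Real.log B with hL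
  have heL : Real.exp L = B := Real.exp_log hB0
  have hL1 : 1 ≤ L := by
    rw [hL, Real.le_log_iff_exp_le hB0]
    linarith [Real.exp_one_lt_d9]
  have hlog : Real.log (bz / δ) + Real.log (poly₁ wb ηb σw ση) = L := by
    rw [hL, hB, Real.log_mul (by positivity) hpoly.ne']
  have hX4 : X ^ 2 ≤ max (wb ^ 4) (ηb ^ 4) := by
    rcases max_cases wb ηb with ⟨h, -⟩ | ⟨h, -⟩ <;> rw [hX, h]
    · exact le_trans (pow_le_pow_right₀ hwb1 (by norm_num)) (le_max_left _ _)
    · exact le_trans (pow_le_pow_right₀ hηb1 (by norm_num)) (le_max_right _ _)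
  have hcast : ((n + m : ℕ) : ℝ) = (m : ℝ) + n := by push_cast; ring
  have hT' : 2200 * ((n + m : ℕ) * X ^ 2 * L) ≤ T := by
    rw [hcast]; exact le_trans (by gcongr) hT
  -- The policy is arbitrary off the visited states, whereas the conditional small-ball estimate
  -- needs a bound at every state.
  set π' : E n → E m := fun x => if ‖π x‖ ≤ bz then π x else 0 with hπ'
  have hπ'm : Measurable π' :=
    Measurable.ite (measurableSet_le hπ.norm measurable_const) hπ measurable_const
  have hπ'b : ∀ x, ‖π' x‖ ≤ bz := fun x => by
    simp only [hπ']
    split_ifs with h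
    · exact h
    · simpa using hbz0.le
  have key := measure_normalEq_error_le (X := X) (L := L) (δ := δ) hn hm hw hη hwη θstar hπ'm x₀
    hπ'b hwmax hηmax hX1 (hwb ▸ hwX) (hηb ▸ hηX) hL1 hδ
    (by rw [heL]; exact le_trans (by gcongr) hBX)
    (by
      rw [heL]
      refine le_trans ?_ hB1
      gcongr
      nlinarith)
    (by rw [heL]; linarith)
    (by rw [two_mul, Real.exp_add, heL, ← sq]; exact hB2)
    (by
      have h1 : wb ^ 2 ≤ X ^ 2 := by gcongr
      have h2 : ηb ^ 2 ≤ X ^ 2 := by gcongr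
      rw [hcast]; linarith)
    hT' rfl rfl
  -- The event in `key` quantifies over all solutions of the normal equations, so no measurable
  -- choice of estimator enters.
  refine (measure_mono_ae ?_).trans (key.trans (ENNReal.ofReal_le_ofReal (by linarith)))
  filter_upwards [hcl, ae_all_iff.2 hη.bdd, hLS, hproj] with ω h1 h2 h3 h4 h5
  have hagree : ∀ t ≤ T, π' (state θstar π x₀ w η t ω) = π (state θstar π x₀ w η t ω) := by
    intro t ht
    refine if_pos ((norm_snd_le_norm_pair _ _).trans (hpair (h1 t ht).1 ?_))
    simpa using (h1 t ht).2 0 (by simpa using hη.nonneg)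
  have hst : ∀ t < T, stacked θstar π' x₀ w η t ω = stacked θstar π x₀ w η t ω := by
    intro t ht
    rw [stacked, stacked, state_congr fun j hj => hagree j (by omega), hagree t ht.le]
  refine ⟨fun t ht => ?_, θhat ω - θstar, fun i a => ?_, ?_⟩
  · rw [hst t ht]
    exact hpair (h1 t ht.le).1 ((h1 t ht.le).2 _ (h2 t))
  · rw [← h3.normalEq (w := fun t => w t ω) (fun s => rfl) i a]
    refine Finset.sum_congr rfl fun t ht => ?_
    rw [hst t (Finset.mem_range.1 ht)]
  · have h6 := h4.norm_sub_le_two_mul hθstar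
    by_contra h7
    push Not at h7
    refine h5 (h6.trans ?_)
    rw [hlog]
    have hT0 : (0 : ℝ) < T := lt_of_lt_of_le (by
      have : (0 : ℝ) < (n + m : ℕ) := by exact_mod_cast (by omega)
      positivity) hT'
    have hsn : √(n : ℝ) ≤ wb := Real.sqrt_le_iff.2 ⟨by linarith, hnw⟩
    -- `25600 = 2 · 8 · 25 · 64`: projection, `y`, the square root of `625` in `l`, and the scale
    -- `s`. One factor `wb` comes from `√n` and the other from `D.wmax / σw`.
    calc 2 * ‖θhat ω - θstar‖
        ≤ 2 * (wb * (D.wmax * (8 * √((n + m : ℕ) * L)) * (25 * X) /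
          (σw * ση / (64 * bz) * √T))) := by
          have h8 : 0 ≤ D.wmax * (8 * √((n + m : ℕ) * L)) * (25 * X) /
              (σw * ση / (64 * bz) * √T) := by
            have := hw.nonneg
            positivity
          have := mul_le_mul_of_nonneg_right hsn h8
          linarith
      _ = 25600 * (bz * √((m : ℝ) + n) / (√(T : ℝ) * ση) * (wb ^ 2 * X) * √L) := by
          rw [hcast, Real.sqrt_mul (by positivity), ← hwσ]
          have : 0 < √(T : ℝ) := Real.sqrt_pos.2 hT0
          field_simp
          norm_num
      _ ≤ _ := by
          gcongr
          exact sq_mul_max_le_poly₂ hwb1 hηb1
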